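/- Let $n\in\mathbb N_0$, $1\le p,q\le\infty$ and $s\in\mathbb R$. Let $\mathcal S=\mathcal S(\mathbb R^n)$ be the Schwartz space, $\mathcal S'$ the space of tempered distributions, and $\mathcal P\subset\mathcal S'$ the subspace of all polynomials with complex coefficients. Let $$\mathcal S_\infty=\Big\{\psi\in\mathcal S:\int_{\mathbb R^n}x^\alpha\psi(x)\,dx=0\text{ for all }\alpha\in\mathbb N_0^n\Big\}$$ with the topology induced by $\mathcal S$, and let $\mathcal S_\infty'$ be its topological dual, with the weakest topology for which $f\mapsto\langle f,\psi\rangle$ is continuous for every $\psi\in\mathcal S_\infty$. The map $[f]\mapsto f|_{\mathcal S_\infty}$ from $\mathcal S'/\mathcal P$ to $\mathcal S_\infty'$ is well defined. Let $\varphi\in\mathcal S$ be real-valued such that either $\chi_{B(4)\setminus B(2)}\le\varphi\le\chi_{B(8)\setminus B(1)}$, or $\varphi=\psi-\psi(2\,\cdot)$ for some real-valued $\psi\in\mathcal S$ with $\chi_{B(1)}\le\psi\le\chi_{B(2)}$, where $B(r)$ is the open ball of radius $r$ centred at the origin. Put $\varphi_j=\varphi(2^{-j}\,\cdot)$ for $j\in\mathbb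 Z$. With the Fourier transform $\mathcal Ff(\xi)=(2\pi)^{-n/2}\int_{\mathbb R^n}f(x)e^{-ix\cdot\xi}\,dx$, extended to $\mathcal S'$, the homogeneous Besov space is $$\dot B^s_{pq}=\Big\{f\in\mathcal S'/\mathcal P:\ \|f\|_{\dot B^s_{pq}}=\Big(\sum_{j\in\mathbb Z}\big(2^{js}\|\mathcal F^{-1}[\varphi_j\cdot\mathcal Ff]\|_{L^p(\mathbb R^n)}\big)^q\Big)^{1/q}<\infty\Big\}$$ (supremum over $j$ if $q=\infty$; the $L^p$ norm of a distribution that is not given by a function in $L^p$ is $\infty$). The expression does not depend on the representative of $f$ modulo $\mathcal P$. Then, for every such $\varphi$: 1. $\dot B^s_{pq}\hookrightarrow\mathcal S_\infty'$, that is, the linear map $\dot B^s_{pq}\to\mathcal S_\infty'$, $[f]\mapsto f|_{\mathcal S_\infty}$, is injective and continuous. 2. $\dot B^s_{pq}$ is complete; that is, $\|\cdot\|_{\dot B^s_{pq}}$ is a norm on $\dot B^s_{pq}$ (in particular $\|f\|_{\dot B^s_{pq}}=0$ only for $f=0$) and $\dot B^s_{pq}$ is a Banach space. -/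

import Mathlib

open MeasureTheory FourierTransform
open scoped SchwartzMap ENNReal

noncomputable section

namespace HomBesov

/-- The Euclidean space `ℝⁿ`. -/
abbrev Rn (n : ℕ) : Type := EuclideanSpace ℝ (Fin n)

variable {n : ℕ}

/-! ### Polynomials as tempered distributions, and the quotient `𝓢' / 𝒫` -/

/-- The function on `ℝⁿ` given by a polynomial with complex coefficients. -/
def polyFun (P : MvPolynomial (Fin n) ℂ) (x : Rn n) : ℂ :=
  MvPolynomial.eval (fun i => (x i : ℂ)) P

theorem coord_hasTemperateGrowth (i : Fin n) :
    (fun x : Rn n => (x i : ℂ)).HasTemperateGrowth :=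
  (Complex.ofRealCLM.comp (EuclideanSpace.proj (𝕜 := ℝ) i)).hasTemperateGrowth

theorem polyFun_hasTemperateGrowth (P : MvPolynomial (Fin n) ℂ) :
    (polyFun P).HasTemperateGrowth := by
  induction P using MvPolynomial.induction_on with
  | C a =>
    have h : polyFun (MvPolynomial.C a) = fun _ : Rn n => a := by ext x; simp [polyFun]
    rw [h]; exact Function.HasTemperateGrowth.const a
  | add P Q hP hQ =>
    have h : polyFun (P + Q) = polyFun P + polyFun Q := by ext x; simp [polyFun]
    rw [h]; exact hP.add hQ
  | mul_X P i hP =>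
    have h : polyFun (P * MvPolynomial.X i) = polyFun P * fun x : Rn n => (x i : ℂ) := by
      ext x; simp [polyFun]
    rw [h]; exact hP.mul (coord_hasTemperateGrowth i)

theorem integrable_smul_polyFun (P : MvPolynomial (Fin n) ℂ) (ψ : 𝓢(Rn n, ℂ)) :
    Integrable (fun x => ψ x • polyFun P x) := by
  have h := (SchwartzMap.smulLeftCLM ℂ (polyFun P) ψ).integrable (μ := volume)
  simpa [SchwartzMap.smulLeftCLM_apply (polyFun_hasTemperateGrowth P), mul_comm] using h

/-- The canonical map sending a polynomial `P` to the tempered distribution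
`φ ↦ ∫ P(x) φ(x) dx`. -/
def polyDistribution (n : ℕ) : MvPolynomial (Fin n) ℂ →ₗ[ℂ] 𝓢'(Rn n, ℂ) where
  toFun P := (polyFun_hasTemperateGrowth P).toTemperedDistribution volume
  map_add' P Q := by
    ext ψ
    have h : ∀ x, ψ x • polyFun (P + Q) x = ψ x • polyFun P x + ψ x • polyFun Q x := by
      intro x; simp [polyFun, mul_add]
    simp only [Function.HasTemperateGrowth.toTemperedDistribution_apply, h]
    exact integral_add (integrable_smul_polyFun P ψ) (integrable_smul_polyFun Q ψ)
  map_smul' c P := by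
    ext ψ
    have h : ∀ x, ψ x • polyFun (c • P) x = c • (ψ x • polyFun P x) := by
      intro x; simp [polyFun, mul_left_comm]
    simp only [Function.HasTemperateGrowth.toTemperedDistribution_apply, h]
    exact integral_smul c _

theorem polyDistribution_apply (P : MvPolynomial (Fin n) ℂ) (ψ : 𝓢(Rn n, ℂ)) :
    polyDistribution n P ψ = ∫ x, ψ x • polyFun P x := rfl

/-- The space `𝒫` of all polynomials, as a subspace of `𝓢'`. -/
def polynomials (n : ℕ) : Submodule ℂ 𝓢'(Rn n, ℂ) := LinearMap.range (polyDistribution n)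

/-- The quotient space `𝓢' / 𝒫`. -/
abbrev TemperedModPoly (n : ℕ) : Type := 𝓢'(Rn n, ℂ) ⧸ polynomials n

/-! ### The space `𝓢_∞`, its dual `𝓢_∞'`, and the restriction map `𝓢' / 𝒫 → 𝓢_∞'` -/

/-- The space `𝓢_∞` of Schwartz functions all of whose moments `∫ x^α ψ(x) dx` vanish. -/
def SInf (n : ℕ) : Submodule ℂ 𝓢(Rn n, ℂ) where
  carrier := {ψ | ∀ α : Fin n →₀ ℕ, ∫ x, ψ x • ∏ i, (x i : ℂ) ^ α i = 0}
  zero_mem' := by intro α; simp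
  add_mem' := by
    intro ψ χ hψ hχ α
    have e : ∀ x : Rn n, ∏ i, (x i : ℂ) ^ α i = polyFun (MvPolynomial.monomial α 1) x := by
      intro x; simp [polyFun, MvPolynomial.eval_monomial, Finsupp.prod_fintype]
    have h1 := hψ α
    have h2 := hχ α
    simp only [e] at h1 h2 ⊢
    have h : ∀ x, (ψ + χ) x • polyFun (MvPolynomial.monomial α 1) x =
        ψ x • polyFun (MvPolynomial.monomial α 1) x +
          χ x • polyFun (MvPolynomial.monomial α 1) x := by
      intro x; simp [add_mul]
    simp only [h]
    rw [integral_add (integrable_smul_polyFun _ ψ) (integrable_smul_polyFun _ χ), h1, h2, add_zero]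
  smul_mem' := by
    intro c ψ hψ α
    have h : ∀ x : Rn n, (c • ψ) x • ∏ i, (x i : ℂ) ^ α i =
        c • (ψ x • ∏ i, (x i : ℂ) ^ α i) := by
      intro x; simp [mul_assoc]
    simp only [h]
    rw [integral_smul, hψ α, smul_zero]

/-- The topological dual `𝓢_∞'` of `𝓢_∞` (which carries the topology induced by `𝓢`), with the
weakest topology for which all evaluations `f ↦ ⟨f, φ⟩`, `φ ∈ 𝓢_∞`, are continuous. -/
abbrev SInfDual (n : ℕ) : Type := SInf n →Lₚₜ[ℂ] ℂ

/-- The restriction map `𝓢' → 𝓢_∞'`, `F ↦ F|𝓢_∞`. -/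
def restrictSInf (n : ℕ) : 𝓢'(Rn n, ℂ) →L[ℂ] SInfDual n :=
  PointwiseConvergenceCLM.precomp ℂ (SInf n).subtypeL

theorem restrictSInf_apply (f : 𝓢'(Rn n, ℂ)) (ψ : SInf n) :
    restrictSInf n f ψ = f (ψ : 𝓢(Rn n, ℂ)) := rfl

theorem polynomials_le_ker_restrictSInf :
    polynomials n ≤ LinearMap.ker (restrictSInf n : 𝓢'(Rn n, ℂ) →ₗ[ℂ] SInfDual n) := by
  rintro _ ⟨P, rfl⟩
  rw [LinearMap.mem_ker]
  ext ψ
  change polyDistribution n P (ψ : 𝓢(Rn n, ℂ)) = 0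
  induction P using MvPolynomial.induction_on' with
  | monomial α a =>
    have h : ∀ x, (ψ : 𝓢(Rn n, ℂ)) x • polyFun (MvPolynomial.monomial α a) x =
        a • ((ψ : 𝓢(Rn n, ℂ)) x • ∏ i, (x i : ℂ) ^ α i) := by
      intro x
      simp [polyFun, MvPolynomial.eval_monomial, Finsupp.prod_fintype, mul_left_comm]
    rw [polyDistribution_apply]
    simp only [h]
    rw [integral_smul, ψ.2 α, smul_zero]
  | add P Q hP hQ =>
    rw [map_add]
    change polyDistribution n P (ψ : 𝓢(Rn n, ℂ)) + polyDistribution n Q (ψ : 𝓢(Rn n, ℂ)) = 0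
    rw [hP, hQ, add_zero]

/-- The canonical map `𝓢' / 𝒫 → 𝓢_∞'`, `[f] ↦ f|𝓢_∞`. -/
def toSInfDual (n : ℕ) : TemperedModPoly n →ₗ[ℂ] SInfDual n :=
  (polynomials n).liftQ (restrictSInf n : 𝓢'(Rn n, ℂ) →ₗ[ℂ] SInfDual n)
    polynomials_le_ker_restrictSInf

/-! ### The dyadic blocks -/

/-- A generator of the dyadic decomposition: a real-valued `φ ∈ 𝓢` which satisfies
`χ_{B(4) ∖ B(2)} ≤ φ ≤ χ_{B(8) ∖ B(1)}`, or which is of the form `φ = ψ - ψ(2 ·)` with `ψ ∈ 𝓢` and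
`χ_{B(1)} ≤ ψ ≤ χ_{B(2)}`. -/
structure DyadicGenerator (n : ℕ) where
  /-- the underlying Schwartz function -/
  toSchwartz : 𝓢(Rn n, ℝ)
  admissible :
    (∀ ξ : Rn n,
      Set.indicator (Metric.ball 0 4 \ Metric.ball 0 2) (fun _ => (1 : ℝ)) ξ ≤ toSchwartz ξ ∧
      toSchwartz ξ ≤ Set.indicator (Metric.ball 0 8 \ Metric.ball 0 1) (fun _ => (1 : ℝ)) ξ) ∨
    ∃ ψ : 𝓢(Rn n, ℝ),
      (∀ ξ : Rn n, Set.indicator (Metric.ball 0 1) (fun _ => (1 : ℝ)) ξ ≤ ψ ξ ∧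
        ψ ξ ≤ Set.indicator (Metric.ball 0 2) (fun _ => (1 : ℝ)) ξ) ∧
      ∀ ξ : Rn n, toSchwartz ξ = ψ ξ - ψ ((2 : ℝ) • ξ)

theorem DyadicGenerator.eq_zero_of_norm_lt (φ : DyadicGenerator n) {ξ : Rn n}
    (hξ : ‖ξ‖ < 1 / 2) : φ.toSchwartz ξ = 0 := by
  rcases φ.admissible with h | ⟨ψ, hψ, h⟩
  · obtain ⟨h1, h2⟩ := h ξ
    rw [Set.indicator_of_notMem (by simp; intros; linarith)] at h1
    rw [Set.indicator_of_notMem (by simp; intros; linarith)] at h2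
    exact le_antisymm h2 h1
  · have key : ∀ η : Rn n, ‖η‖ < 1 → ψ η = 1 := by
      intro η hη
      obtain ⟨h1, h2⟩ := hψ η
      rw [Set.indicator_of_mem (by simpa using hη)] at h1
      rw [Set.indicator_of_mem (by simp; linarith)] at h2
      exact le_antisymm h2 h1
    rw [h, key ξ (by linarith), key ((2 : ℝ) • ξ) (by rw [norm_smul]; norm_num; linarith), sub_self]

/-- The symbol of the `j`-th dyadic block with respect to Mathlib's Fourier transform.

If `ℱ f(ξ) = (2π)^{-n/2} ∫ f(x) e^{-i x·ξ} dx` and `𝓕 f(η) = ∫ f(x) e^{-2πi x·η} dx`, then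
`ℱ f(2πη) = (2π)^{-n/2} 𝓕 f(η)`, whence `ℱ⁻¹[φ_j · ℱ f] = 𝓕⁻¹[φ_j(2π ·) · 𝓕 f]`, where
`φ_j(ξ) = φ(2^{-j} ξ)`. -/
def DyadicGenerator.symbol (φ : DyadicGenerator n) (j : ℤ) (η : Rn n) : ℂ :=
  ((φ.toSchwartz ((2 : ℝ) ^ (-j) • ((2 * Real.pi) • η)) : ℝ) : ℂ)

theorem DyadicGenerator.symbol_hasTemperateGrowth (φ : DyadicGenerator n) (j : ℤ) :
    (φ.symbol j).HasTemperateGrowth := by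
  have h1 : (fun η : Rn n => (2 : ℝ) ^ (-j) • ((2 * Real.pi) • η)).HasTemperateGrowth :=
    ((2 : ℝ) ^ (-j) • ((2 * Real.pi) • ContinuousLinearMap.id ℝ (Rn n))).hasTemperateGrowth
  exact Function.Complex.hasTemperateGrowth_ofReal.comp (φ.toSchwartz.hasTemperateGrowth.comp h1)

/-- The operator `f ↦ ℱ⁻¹[φ_j · ℱ f]` on `𝓢'`, where `φ_j(ξ) = φ(2^{-j} ξ)` and
`ℱ f(ξ) = (2π)^{-n/2} ∫ f(x) e^{-i x·ξ} dx`. -/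
def DyadicGenerator.block (φ : DyadicGenerator n) (j : ℤ) : 𝓢'(Rn n, ℂ) →L[ℂ] 𝓢'(Rn n, ℂ) :=
  TemperedDistribution.fourierMultiplierCLM ℂ (φ.symbol j)

theorem eventually_lineDeriv_eq_zero {g : 𝓢(Rn n, ℂ)} (hg : ∀ᶠ x in nhds (0 : Rn n), g x = 0)
    (m : Rn n) : ∀ᶠ x in nhds (0 : Rn n), (LineDeriv.lineDerivOp m g : 𝓢(Rn n, ℂ)) x = 0 := by
  filter_upwards [hg.eventually_nhds] with y hy
  have h : (g : Rn n → ℂ) =ᶠ[nhds y] fun _ => 0 := hy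
  rw [SchwartzMap.lineDerivOp_apply_eq_fderiv, h.fderiv_eq]
  simp

/-- Multiplication of `𝓕 g` by a polynomial amounts to differentiation of `g`. -/
theorem exists_fourier_eq_polyFun_mul (P : MvPolynomial (Fin n) ℂ) {g : 𝓢(Rn n, ℂ)}
    (hg : ∀ᶠ x in nhds (0 : Rn n), g x = 0) :
    ∃ h : 𝓢(Rn n, ℂ), (∀ᶠ x in nhds (0 : Rn n), h x = 0) ∧
      ∀ x, (𝓕 g) x * polyFun P x = (𝓕 h) x := by
  induction P using MvPolynomial.induction_on with
  | C a =>
    refine ⟨a • g, ?_, fun x => ?_⟩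
    · filter_upwards [hg] with x hx
      simp [hx]
    · rw [FourierTransform.fourier_smul]
      simp [polyFun, mul_comm]
  | add P Q hP hQ =>
    obtain ⟨h₁, hz₁, e₁⟩ := hP
    obtain ⟨h₂, hz₂, e₂⟩ := hQ
    refine ⟨h₁ + h₂, ?_, fun x => ?_⟩
    · filter_upwards [hz₁, hz₂] with x hx hy
      simp [hx, hy]
    · rw [FourierTransform.fourier_add, add_apply, ← e₁, ← e₂]
      simp [polyFun, mul_add]
  | mul_X P i hP =>
    obtain ⟨h, hz, e⟩ := hP
    refine ⟨(2 * Real.pi * Complex.I)⁻¹ •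
      (LineDeriv.lineDerivOp (EuclideanSpace.single i (1 : ℝ)) h : 𝓢(Rn n, ℂ)), ?_, fun x => ?_⟩
    · filter_upwards [eventually_lineDeriv_eq_zero hz (EuclideanSpace.single i (1 : ℝ))] with x hx
      simp [hx]
    · have hi : (inner ℝ · (EuclideanSpace.single i (1 : ℝ)) : Rn n → ℝ).HasTemperateGrowth := by
        fun_prop
      have hc : (2 * Real.pi * Complex.I : ℂ) ≠ 0 := by simp [Real.pi_ne_zero]
      rw [FourierTransform.fourier_smul, SchwartzMap.fourier_lineDerivOp_eq, smul_smul,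
        inv_mul_cancel₀ hc, one_smul, SchwartzMap.smulLeftCLM_apply_apply hi, ← e]
      simp [polyFun, EuclideanSpace.inner_single_right]
      ring

/-- All moments of `𝓕 g` vanish if `g` vanishes near the origin. -/
theorem integral_fourier_mul_polyFun (P : MvPolynomial (Fin n) ℂ) {g : 𝓢(Rn n, ℂ)}
    (hg : ∀ᶠ x in nhds (0 : Rn n), g x = 0) : ∫ x, (𝓕 g) x • polyFun P x = 0 := by
  obtain ⟨h, hz, e⟩ := exists_fourier_eq_polyFun_mul P hg
  simp only [smul_eq_mul, e]
  have h0 : (𝓕⁻ (𝓕 h)) (0 : Rn n) = h 0 := by rw [FourierTransform.fourierInv_fourier_eq]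
  rw [SchwartzMap.fourierInv_coe, Real.fourierInv_eq] at h0
  simpa [hz.self_of_nhds] using h0

theorem DyadicGenerator.polynomials_le_ker_block (φ : DyadicGenerator n) (j : ℤ) :
    polynomials n ≤ LinearMap.ker (φ.block j : 𝓢'(Rn n, ℂ) →ₗ[ℂ] 𝓢'(Rn n, ℂ)) := by
  rintro _ ⟨P, rfl⟩
  rw [LinearMap.mem_ker]
  ext ψ
  change polyDistribution n P (𝓕 (SchwartzMap.smulLeftCLM ℂ (φ.symbol j) (𝓕⁻ ψ))) = 0
  rw [polyDistribution_apply]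
  refine integral_fourier_mul_polyFun P ?_
  have hcont : Continuous fun η : Rn n => ‖(2 : ℝ) ^ (-j) • ((2 * Real.pi) • η)‖ := by fun_prop
  have hev : ∀ᶠ η in nhds (0 : Rn n), ‖(2 : ℝ) ^ (-j) • ((2 * Real.pi) • η)‖ < 1 / 2 :=
    hcont.continuousAt.eventually_lt_const (by simp)
  filter_upwards [hev] with η hη
  rw [SchwartzMap.smulLeftCLM_apply_apply (φ.symbol_hasTemperateGrowth j), DyadicGenerator.symbol,
    φ.eq_zero_of_norm_lt hη]
  simp

/-- The operator `[f] ↦ ℱ⁻¹[φ_j · ℱ f]` on `𝓢' / 𝒫`; it is well defined since `φ_j` vanishes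
near the origin. -/
def DyadicGenerator.blockModPoly (φ : DyadicGenerator n) (j : ℤ) :
    TemperedModPoly n →ₗ[ℂ] 𝓢'(Rn n, ℂ) :=
  (polynomials n).liftQ (φ.block j : 𝓢'(Rn n, ℂ) →ₗ[ℂ] 𝓢'(Rn n, ℂ)) (φ.polynomials_le_ker_block j)

/-! ### The homogeneous Besov norm -/

/-- The norm `‖g‖_p ∈ [0, ∞]` of a tempered distribution `g`: it is `‖u‖_p` if `g` is represented by
the (unique) function `u ∈ L^p(ℝⁿ)`, and `∞` if `g` is not represented by a function in `L^p`. -/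
def lpENorm (p : ℝ≥0∞) [Fact (1 ≤ p)] (g : 𝓢'(Rn n, ℂ)) : ℝ≥0∞ :=
  ⨅ (u : Lp ℂ p (volume : Measure (Rn n))) (_ : Lp.toTemperedDistribution u = g), ‖u‖ₑ

theorem lpENorm_add_le (p : ℝ≥0∞) [Fact (1 ≤ p)] (g h : 𝓢'(Rn n, ℂ)) :
    lpENorm p (g + h) ≤ lpENorm p g + lpENorm p h := by
  refine ENNReal.le_iInf₂_add_iInf₂ fun u hu v hv => ?_
  have h1 : Lp.toTemperedDistribution (u + v) = g + h := by
    rw [← hu, ← hv]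
    exact map_add (Lp.toTemperedDistributionCLM ℂ (volume : Measure (Rn n)) p) u v
  exact (iInf₂_le (u + v) h1).trans (enorm_add_le u v)

theorem lpENorm_smul_le (p : ℝ≥0∞) [Fact (1 ≤ p)] (c : ℂ) (g : 𝓢'(Rn n, ℂ)) :
    lpENorm p (c • g) ≤ ‖c‖ₑ * lpENorm p g := by
  have key : ∀ (d : ℂ) (u : Lp ℂ p (volume : Measure (Rn n))) (g : 𝓢'(Rn n, ℂ)),
      Lp.toTemperedDistribution u = g → lpENorm p (d • g) ≤ ‖d‖ₑ * ‖u‖ₑ := by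
    intro d u g hu
    have h1 : Lp.toTemperedDistribution (d • u) = d • g := by
      rw [← hu]
      exact map_smul (Lp.toTemperedDistributionCLM ℂ (volume : Measure (Rn n)) p) d u
    exact (iInf₂_le (d • u) h1).trans (enorm_smul d u).le
  rcases eq_or_ne c 0 with rfl | hc
  · have h0 : Lp.toTemperedDistribution (0 : Lp ℂ p (volume : Measure (Rn n))) = (0 : ℂ) • g :=
      (map_zero (Lp.toTemperedDistributionCLM ℂ (volume : Measure (Rn n)) p)).trans
        (zero_smul ℂ g).symm
    exact (iInf₂_le 0 h0).trans (by simp)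
  · have hc0 : ‖c‖ₑ ≠ 0 := by simpa using hc
    rw [lpENorm, lpENorm, ENNReal.mul_iInf_of_ne hc0 enorm_ne_top]
    refine le_iInf fun u => ?_
    rw [ENNReal.mul_iInf_of_ne hc0 enorm_ne_top]
    exact le_iInf fun hu => key c u g hu

/-- The homogeneous Besov norm
`‖f‖ = (∑_{j ∈ ℤ} (2^{js} ‖ℱ⁻¹[φ_j · ℱ f]‖_p)^q)^{1/q} ∈ [0, ∞]` of `f ∈ 𝓢' / 𝒫`, to be read as
`sup_{j ∈ ℤ} 2^{js} ‖ℱ⁻¹[φ_j · ℱ f]‖_p` if `q = ∞`. -/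
def besovENorm (φ : DyadicGenerator n) (s : ℝ) (p q : ℝ≥0∞) [Fact (1 ≤ p)]
    (f : TemperedModPoly n) : ℝ≥0∞ :=
  eLpNorm (fun j : ℤ => (2 : ℝ≥0∞) ^ ((j : ℝ) * s) * lpENorm p (φ.blockModPoly j f)) q
    Measure.count

section

variable (φ : DyadicGenerator n) (s : ℝ) (p q : ℝ≥0∞) [Fact (1 ≤ p)]

theorem besovENorm_smul_le (c : ℂ) (f : TemperedModPoly n) :
    besovENorm φ s p q (c • f) ≤ ‖c‖ₑ * besovENorm φ s p q f := by
  refine eLpNorm_le_nnreal_smul_eLpNorm_of_ae_le_mul' (c := ‖c‖₊)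
    (Filter.Eventually.of_forall fun j => ?_) q
  simp only [enorm_eq_self, map_smul]
  calc _ ≤ (2 : ℝ≥0∞) ^ ((j : ℝ) * s) * (‖c‖ₑ * lpENorm p (φ.blockModPoly j f)) := by
        gcongr; exact lpENorm_smul_le p c _
    _ = _ := by rw [mul_left_comm]; rfl

theorem besovENorm_zero : besovENorm φ s p q 0 = 0 := by
  have h := besovENorm_smul_le φ s p q 0 0
  simpa using h

variable [Fact (1 ≤ q)]

theorem besovENorm_add_le (f g : TemperedModPoly n) :
    besovENorm φ s p q (f + g) ≤ besovENorm φ s p q f + besovENorm φ s p q g := by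
  refine le_trans ?_ (eLpNorm_add_le (μ := (Measure.count : Measure ℤ)) (p := q)
    (measurable_of_countable _).aestronglyMeasurable
    (measurable_of_countable _).aestronglyMeasurable Fact.out)
  refine eLpNorm_mono_enorm fun j => ?_
  simp only [enorm_eq_self, map_add, Pi.add_apply, ← mul_add]
  gcongr
  exact lpENorm_add_le p _ _

/-- The homogeneous Besov space, as the subspace of all `f ∈ 𝓢' / 𝒫` of finite Besov norm. -/
def besovSubmodule : Submodule ℂ (TemperedModPoly n) where
  carrier := {f | besovENorm φ s p q f < ∞}
  zero_mem' := by simp [besovENorm_zero]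
  add_mem' := fun {f g} hf hg =>
    (besovENorm_add_le φ s p q f g).trans_lt (ENNReal.add_lt_top.2 ⟨hf, hg⟩)
  smul_mem' := fun c f hf =>
    (besovENorm_smul_le φ s p q c f).trans_lt (ENNReal.mul_lt_top enorm_lt_top hf)

/-- The homogeneous Besov space `Ḃ^s_{pq}(ℝⁿ)`. It is a type of its own and not literally the subtype
of `𝓢' / 𝒫`, so that it carries the topology of the Besov norm and not the subspace topology. -/
def HomogeneousBesov : Type := besovSubmodule φ s p q

namespace HomogeneousBesov

instance : AddCommGroup (HomogeneousBesov φ s p q) :=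
  inferInstanceAs (AddCommGroup (besovSubmodule φ s p q))

instance : Module ℂ (HomogeneousBesov φ s p q) :=
  inferInstanceAs (Module ℂ (besovSubmodule φ s p q))

/-- The inclusion `Ḃ^s_{pq} ⊆ 𝓢' / 𝒫`. -/
def incl : HomogeneousBesov φ s p q →ₗ[ℂ] TemperedModPoly n := (besovSubmodule φ s p q).subtype

theorem besovENorm_incl_lt_top (f : HomogeneousBesov φ s p q) :
    besovENorm φ s p q (incl φ s p q f) < ∞ := f.2

/-- `Ḃ^s_{pq}` with the (semi-)norm `f ↦ ‖f‖`, the finite value of `besovENorm`. -/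
instance : SeminormedAddCommGroup (HomogeneousBesov φ s p q) :=
  AddGroupSeminorm.toSeminormedAddCommGroup
    { toFun := fun f => (besovENorm φ s p q (incl φ s p q f)).toReal
      map_zero' := by simp [besovENorm_zero]
      add_le' := fun f g => by
        rw [map_add, ← ENNReal.toReal_add (besovENorm_incl_lt_top φ s p q f).ne
          (besovENorm_incl_lt_top φ s p q g).ne]
        exact ENNReal.toReal_mono (ENNReal.add_lt_top.2 ⟨besovENorm_incl_lt_top φ s p q f,
          besovENorm_incl_lt_top φ s p q g⟩).ne (besovENorm_add_le φ s p q _ _)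
      neg' := fun f => by
        have key : ∀ g : TemperedModPoly n,
            besovENorm φ s p q (-g) ≤ besovENorm φ s p q g := fun g => by
          have h := besovENorm_smul_le φ s p q (-1) g
          simpa using h
        rw [map_neg]
        congr 1
        refine le_antisymm (key _) ?_
        have h := key (-(incl φ s p q f))
        rwa [neg_neg] at h }

theorem norm_def (f : HomogeneousBesov φ s p q) :
    ‖f‖ = (besovENorm φ s p q (incl φ s p q f)).toReal := rfl

instance : NormedSpace ℂ (HomogeneousBesov φ s p q) where
  norm_smul_le c f := by
    rw [norm_def, norm_def, map_smul, ← toReal_enorm c, ← ENNReal.toReal_mul]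
    exact ENNReal.toReal_mono (ENNReal.mul_lt_top enorm_lt_top
      (besovENorm_incl_lt_top φ s p q f)).ne (besovENorm_smul_le φ s p q c _)

/-- The canonical map `Ḃ^s_{pq} → 𝓢_∞'`, `[f] ↦ f|𝓢_∞`. -/
def toSInfDual : HomogeneousBesov φ s p q →ₗ[ℂ] SInfDual n :=
  HomBesov.toSInfDual n ∘ₗ incl φ s p q

end HomogeneousBesov

end

end HomBesov

end

/-! Both claims rest on one estimate: there is a continuous seminorm `P` on `𝓢`, independent of `f`,
with `|⟨f, ψ⟩| ≤ ‖f‖ P(ψ)` for all `ψ ∈ 𝓢_∞` (`DyadicGenerator.exists_seminorm_apply_le`). For `ψ ∈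
𝓢_∞` the function `g = 𝓕⁻ ψ` is flat to infinite order at the origin. Its localization to the
annulus `|x| ~ 2^j` is therefore smaller than any power of `2^{-|j|}` in every Schwartz seminorm: by
decay at infinity for `j → ∞`, by flatness for `j → -∞` (`exists_seminorm_cutoff_zpow_le`). With a
dual generator `χ`, `∑ φ_j χ_j = 1` off the origin (`exists_dual`), `⟨f, ψ⟩` becomes the sum over
`j` of the `j`-th block of `f` tested against `𝓕 (χ_j g)`. Hölder's inequality bounds each term, and
the rapid decay beats the factor `2^{-js}`.

Continuity follows at once. Injectivity is a fact about `𝓢' / 𝒫` alone: if `f` vanishes on `𝓢_∞`,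
then `f ∘ 𝓕` vanishes on functions that are zero near the origin. Being continuous, it then vanishes
on functions flat to some finite order (`exists_order_of_forall_eventually_eq_zero`), so `f` is a
combination of finitely many moment functionals, that is, a polynomial. Injectivity and the estimate
show that the seminorm is a norm.

For completeness, a Cauchy sequence converges pointwise on `𝓢_∞`; the estimate bounds the limit by a
continuous seminorm, and Hahn–Banach extends it to a tempered distribution. Its blocks are the `L^p`
limits of the blocks, and Fatou's lemma in `ℓ^q` gives convergence in norm. -/

noncomputable section

namespace HomBesov

variable {n : ℕ}

/-! ### Dyadic localization of flat Schwartz functions. -/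

section Flat

variable {E F : Type*} [NormedAddCommGroup E] [NormedSpace ℝ E]
  [NormedAddCommGroup F] [NormedSpace ℝ F] [NormedSpace ℂ F] [SMulCommClass ℝ ℂ F]

/-- A Schwartz function whose derivatives of order `l, …, l + K - 1` vanish at the origin has
an `l`-th derivative of size `O(‖x‖ ^ K)`. -/
theorem norm_iteratedFDeriv_le_of_flat (g : 𝓢(E, F)) (K l : ℕ)
    (hg : ∀ i, l ≤ i → i < l + K → iteratedFDeriv ℝ i g 0 = 0) (x : E) :
    ‖iteratedFDeriv ℝ l g x‖ ≤ ‖x‖ ^ K * SchwartzMap.seminorm ℂ 0 (l + K) g := by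
  induction K generalizing l x with
  | zero => simpa using SchwartzMap.norm_iteratedFDeriv_le_seminorm ℂ g l x
  | succ K ih =>
    -- The induction hypothesis at order `l + 1` bounds the derivative on the whole ball; the mean
    -- value inequality from the origin then gains one factor `‖x‖`.
    have hstep : ∀ y ∈ Metric.closedBall (0 : E) ‖x‖,
        ‖fderiv ℝ (iteratedFDeriv ℝ l g) y‖ ≤
          ‖x‖ ^ K * SchwartzMap.seminorm ℂ 0 (l + (K + 1)) g := by
      intro y hy
      rw [norm_fderiv_iteratedFDeriv]
      have h1 := ih (l + 1) (fun i h1 h2 => hg i (by omega) (by omega)) y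
      rw [show l + 1 + K = l + (K + 1) by ring] at h1
      refine h1.trans ?_
      have : ‖y‖ ≤ ‖x‖ := by simpa using hy
      gcongr
    have hd : ∀ y ∈ Metric.closedBall (0 : E) ‖x‖,
        DifferentiableAt ℝ (iteratedFDeriv ℝ l g) y := fun y _ =>
      ((g.smooth (l + 1)).differentiable_iteratedFDeriv (by exact_mod_cast Nat.lt_succ_self l)) y
    have := (convex_closedBall (0 : E) ‖x‖).norm_image_sub_le_of_norm_fderiv_le hd hstep
      (Metric.mem_closedBall_self (norm_nonneg x)) (y := x) (by simp)
    rw [hg l le_rfl (by omega), sub_zero, sub_zero] at this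
    calc _ ≤ _ := this
      _ = _ := by ring

/-- Dilations of Schwartz functions have temperate growth. -/
theorem dilation_hasTemperateGrowth (a : 𝓢(E, ℂ)) (c : ℝ) :
    (fun x : E => a (c • x)).HasTemperateGrowth :=
  a.hasTemperateGrowth.comp (c • ContinuousLinearMap.id ℝ E).hasTemperateGrowth

/-- The product of a Schwartz function with the dilation of a cut-off function `a`. -/
def cutoff (a : 𝓢(E, ℂ)) (c : ℝ) : 𝓢(E, ℂ) →L[ℂ] 𝓢(E, ℂ) :=
  SchwartzMap.smulLeftCLM ℂ fun x : E => a (c • x)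

theorem cutoff_apply (a : 𝓢(E, ℂ)) (c : ℝ) (g : 𝓢(E, ℂ)) (x : E) :
    cutoff a c g x = a (c • x) * g x := by
  rw [cutoff, SchwartzMap.smulLeftCLM_apply_apply (dilation_hasTemperateGrowth a c), smul_eq_mul]

/-- Leibniz' rule: `i` derivatives falling on the dilated cut-off cost `|c| ^ i`, and `g` matters
only where the cut-off lives. The bound `B` is left open so that both regimes `c ≥ 1` and `c ≤ 1`
can be treated. -/
theorem seminorm_cutoff_le (a g : 𝓢(E, ℂ)) (c : ℝ) (k m : ℕ) (B : ℕ → ℝ) (hB : ∀ l, 0 ≤ B l)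
    (h : ∀ x, c • x ∈ tsupport a → ∀ l ≤ m, ‖x‖ ^ k * ‖iteratedFDeriv ℝ l g x‖ ≤ B l) :
    SchwartzMap.seminorm ℂ k m (cutoff a c g) ≤
      ∑ i ∈ Finset.range (m + 1), (m.choose i : ℝ) *
        (|c| ^ i * SchwartzMap.seminorm ℂ 0 i a) * B (m - i) := by
  refine SchwartzMap.seminorm_le_bound ℂ k m _
    (Finset.sum_nonneg fun i _ => mul_nonneg (by positivity) (hB _)) fun x => ?_
  have hfun : (cutoff a c g : E → ℂ) = fun x => a (c • x) * g x :=
    funext fun x => cutoff_apply a c g x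
  rw [hfun]
  have hda : ∀ i, iteratedFDeriv ℝ i (fun x : E => a (c • x)) x =
      c ^ i • iteratedFDeriv ℝ i a (c • x) := fun i => by
    rw [iteratedFDeriv_comp_const_smul c (a.smooth i)]
  have ha : ContDiff ℝ m (fun x : E => a (c • x)) :=
    (a.smooth m).comp (contDiff_const_smul c)
  have h1 := norm_iteratedFDeriv_mul_le (n := m) ha (g.smooth m) x le_rfl
  refine (mul_le_mul_of_nonneg_left h1 (by positivity)).trans ?_
  rw [Finset.mul_sum]
  refine Finset.sum_le_sum fun i hi => ?_
  rw [hda, norm_smul, norm_pow, Real.norm_eq_abs]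
  by_cases hx : c • x ∈ tsupport a
  · have h2 := h x hx (m - i) (Nat.sub_le _ _)
    have h3 := SchwartzMap.norm_iteratedFDeriv_le_seminorm ℂ a i (c • x)
    calc _ = (m.choose i : ℝ) * (|c| ^ i * ‖iteratedFDeriv ℝ i a (c • x)‖) *
          (‖x‖ ^ k * ‖iteratedFDeriv ℝ (m - i) g x‖) := by ring
      _ ≤ _ := by gcongr
  · have h2 : iteratedFDeriv ℝ i a (c • x) = 0 := by
      by_contra h3
      exact hx (support_iteratedFDeriv_subset i h3)
    rw [h2, norm_zero]
    have := hB (m - i)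
    simp only [mul_zero, zero_mul]
    positivity

/-- Cutting off a Schwartz function near the origin, on the scale `c⁻¹ ≤ 1`, gains a power of the
scale if the function vanishes to high order at the origin. -/
theorem exists_seminorm_cutoff_le_of_one_le (a : 𝓢(E, ℂ)) {R : ℝ}
    (ha : tsupport a ⊆ Metric.closedBall 0 R) (k : ℕ) {m K : ℕ} (hm : m ≤ K) :
    ∃ C : ℝ, 0 ≤ C ∧ ∀ c : ℝ, 1 ≤ c → ∀ g : 𝓢(E, ℂ), (∀ i < K, iteratedFDeriv ℝ i g 0 = 0) →
      SchwartzMap.seminorm ℂ k m (cutoff a c g) ≤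
        C * (c⁻¹) ^ (K - m) * SchwartzMap.seminorm ℂ 0 K g := by
  -- `R` carries no sign condition; the maximum keeps the constants nonnegative.
  set R' := max R 1
  have hR : 1 ≤ R' := le_max_right _ _
  refine ⟨∑ i ∈ Finset.range (m + 1), (m.choose i : ℝ) * SchwartzMap.seminorm ℂ 0 i a *
    (R' ^ k * R' ^ (K - (m - i))), Finset.sum_nonneg fun i _ => by positivity,
    fun c hc g hg => ?_⟩
  have hc0 : 0 < c := by linarith
  have key := seminorm_cutoff_le a g c k m
    (fun l => R' ^ k * (R' * c⁻¹) ^ (K - l) * SchwartzMap.seminorm ℂ 0 K g)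
    (fun l => by positivity) (fun x hx l hl => ?_)
  · refine key.trans (le_of_eq ?_)
    rw [Finset.sum_mul, Finset.sum_mul]
    refine Finset.sum_congr rfl fun i hi => ?_
    have hi : i ≤ m := Nat.lt_succ_iff.1 (Finset.mem_range.1 hi)
    -- The `i` surplus factors `c⁻¹` cancel the `c ^ i` from Leibniz' rule; truncated subtraction is
    -- harmless because `i ≤ m ≤ K`.
    have e : K - (m - i) = (K - m) + i := by omega
    have e2 : c ^ i * (c⁻¹) ^ i = 1 := by rw [← mul_pow, mul_inv_cancel₀ hc0.ne', one_pow]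
    rw [abs_of_pos hc0, e, mul_pow, pow_add (c⁻¹)]
    calc _ = (m.choose i : ℝ) * SchwartzMap.seminorm ℂ 0 i a * (R' ^ k * R' ^ (K - m + i)) *
          c⁻¹ ^ (K - m) * SchwartzMap.seminorm ℂ 0 K g * (c ^ i * (c⁻¹) ^ i) := by ring
      _ = _ := by rw [e2, mul_one]
  · have h1 : ‖c • x‖ ≤ R' := (by simpa using ha hx : ‖c • x‖ ≤ R).trans (le_max_left _ _)
    rw [norm_smul, Real.norm_eq_abs, abs_of_pos hc0] at h1
    have h2 : ‖x‖ ≤ R' * c⁻¹ := by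
      rw [← div_eq_mul_inv, le_div_iff₀ hc0]; linarith
    have h3 : ‖x‖ ≤ R' := by nlinarith [norm_nonneg x]
    have h4 := norm_iteratedFDeriv_le_of_flat g (K - l) l (fun i _ hi => hg i (by omega)) x
    rw [show l + (K - l) = K by omega] at h4
    calc _ ≤ R' ^ k * ((R' * c⁻¹) ^ (K - l) * SchwartzMap.seminorm ℂ 0 K g) := by
          gcongr
          exact h4.trans (by gcongr)
      _ = _ := by ring

/-- Localizing a Schwartz function to an annulus of size `c⁻¹ ≥ 1` gains any power of `c`. -/
theorem exists_seminorm_cutoff_le_of_le_one (a : 𝓢(E, ℂ)) {r : ℝ} (hr : 0 < r)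
    (ha : ∀ x ∈ tsupport a, r ≤ ‖x‖) (k m K : ℕ) :
    ∃ C : ℝ, 0 ≤ C ∧ ∀ c : ℝ, 0 < c → c ≤ 1 → ∀ g : 𝓢(E, ℂ),
      SchwartzMap.seminorm ℂ k m (cutoff a c g) ≤
        C * c ^ K * ∑ l ∈ Finset.range (m + 1), SchwartzMap.seminorm ℂ (k + K) l g := by
  refine ⟨∑ i ∈ Finset.range (m + 1), (m.choose i : ℝ) * SchwartzMap.seminorm ℂ 0 i a *
    (r⁻¹) ^ K, Finset.sum_nonneg fun i _ => by positivity, fun c hc0 hc g => ?_⟩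
  set T := ∑ l ∈ Finset.range (m + 1), SchwartzMap.seminorm ℂ (k + K) l g
  have hT : 0 ≤ T := Finset.sum_nonneg fun i _ => apply_nonneg _ _
  have key := seminorm_cutoff_le a g c k m (fun _ => (c * r⁻¹) ^ K * T)
    (fun l => by positivity) (fun x hx l hl => ?_)
  · refine key.trans ?_
    rw [Finset.sum_mul, Finset.sum_mul]
    refine Finset.sum_le_sum fun i hi => ?_
    have h1 : |c| ^ i ≤ 1 := pow_le_one₀ (abs_nonneg _) (by rwa [abs_of_pos hc0])
    calc _ ≤ (m.choose i : ℝ) * (1 * SchwartzMap.seminorm ℂ 0 i a) * ((c * r⁻¹) ^ K * T) := by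
          gcongr
      _ = _ := by rw [mul_pow]; ring
  · have h1 := ha _ hx
    rw [norm_smul, Real.norm_eq_abs, abs_of_pos hc0] at h1
    -- On the support this quantity is at least one, so its `K`-th power can be inserted: it yields
    -- `c ^ K` and raises the weight from `k` to `k + K`.
    have h2 : 1 ≤ c * r⁻¹ * ‖x‖ := by
      rw [mul_right_comm, ← div_eq_mul_inv, le_div_iff₀ hr]; linarith
    have h3 := SchwartzMap.le_seminorm ℂ (k + K) l g x
    have h4 : SchwartzMap.seminorm ℂ (k + K) l g ≤ T :=
      Finset.single_le_sum (f := fun l => SchwartzMap.seminorm ℂ (k + K) l g)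
        (fun i _ => apply_nonneg _ _) (Finset.mem_range.2 (Nat.lt_succ_iff.2 hl))
    calc ‖x‖ ^ k * ‖iteratedFDeriv ℝ l g x‖
        = 1 ^ K * (‖x‖ ^ k * ‖iteratedFDeriv ℝ l g x‖) := by simp
      _ ≤ (c * r⁻¹ * ‖x‖) ^ K * (‖x‖ ^ k * ‖iteratedFDeriv ℝ l g x‖) := by gcongr
      _ = (c * r⁻¹) ^ K * (‖x‖ ^ (k + K) * ‖iteratedFDeriv ℝ l g x‖) := by
          rw [mul_pow, pow_add]; ring
      _ ≤ _ := by gcongr; exact h3.trans h4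

/-- A dyadic localization of a Schwartz function that is flat at the origin decays rapidly in
both directions. -/
theorem exists_seminorm_cutoff_zpow_le (a : 𝓢(E, ℂ)) {r R : ℝ} (hr : 0 < r)
    (ha : ∀ x ∈ tsupport a, r ≤ ‖x‖) (ha' : tsupport a ⊆ Metric.closedBall 0 R) (k m K : ℕ) :
    ∃ p : Seminorm ℂ 𝓢(E, ℂ), Continuous p ∧ ∀ (j : ℤ) (g : 𝓢(E, ℂ)),
      (∀ i, iteratedFDeriv ℝ i g 0 = 0) →
      SchwartzMap.seminorm ℂ k m (cutoff a ((2 : ℝ) ^ (-j)) g) ≤ ((2 : ℝ)⁻¹ ^ K) ^ j.natAbs * p g := by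
  -- Flatness is used to order `m + K`: the `m` derivatives consume `m` orders and leave the
  -- exponent `K`.
  obtain ⟨C₁, hC₁, h₁⟩ := exists_seminorm_cutoff_le_of_one_le a ha' k (Nat.le_add_right m K)
  obtain ⟨C₂, hC₂, h₂⟩ := exists_seminorm_cutoff_le_of_le_one a hr ha k m K
  have hcont : ∀ k m, Continuous (SchwartzMap.seminorm ℂ k m : Seminorm ℂ 𝓢(E, ℂ)) := fun k m =>
    (schwartz_withSeminorms ℂ E ℂ).continuous_seminorm (k, m)
  refine ⟨C₁.toNNReal • SchwartzMap.seminorm ℂ 0 (m + K) +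
    C₂.toNNReal • ∑ l ∈ Finset.range (m + 1), SchwartzMap.seminorm ℂ (k + K) l, ?_, ?_⟩
  · have e : ((C₁.toNNReal • SchwartzMap.seminorm ℂ 0 (m + K) +
      C₂.toNNReal • ∑ l ∈ Finset.range (m + 1), SchwartzMap.seminorm ℂ (k + K) l :
        Seminorm ℂ 𝓢(E, ℂ)) : 𝓢(E, ℂ) → ℝ) = fun g => C₁ * SchwartzMap.seminorm ℂ 0 (m + K) g +
        C₂ * ∑ l ∈ Finset.range (m + 1), SchwartzMap.seminorm ℂ (k + K) l g := by
      ext g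
      simp [NNReal.smul_def, hC₁, hC₂]
    rw [e]
    have := hcont 0 (m + K)
    have := fun l => hcont (k + K) l
    fun_prop
  · intro j g hg
    have e : ((C₁.toNNReal • SchwartzMap.seminorm ℂ 0 (m + K) +
      C₂.toNNReal • ∑ l ∈ Finset.range (m + 1), SchwartzMap.seminorm ℂ (k + K) l :
        Seminorm ℂ 𝓢(E, ℂ)) g) = C₁ * SchwartzMap.seminorm ℂ 0 (m + K) g +
        C₂ * ∑ l ∈ Finset.range (m + 1), SchwartzMap.seminorm ℂ (k + K) l g := by
      simp [NNReal.smul_def, hC₁, hC₂]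
    rw [e]
    have hs : 0 ≤ ∑ l ∈ Finset.range (m + 1), SchwartzMap.seminorm ℂ (k + K) l g :=
      Finset.sum_nonneg fun i _ => apply_nonneg _ _
    rw [← pow_mul, mul_comm K, pow_mul]
    -- For `j ≥ 0` the annulus is large and decay at infinity is used; for `j ≤ 0` it is small and
    -- flatness is used.
    rcases le_total 0 j with hj | hj
    · have e2 : (2 : ℝ) ^ (-j) = (2 : ℝ)⁻¹ ^ j.natAbs := by
        rw [zpow_neg, inv_pow, ← zpow_natCast, Int.natCast_natAbs, abs_of_nonneg hj]
      have h := h₂ ((2 : ℝ) ^ (-j)) (by positivity)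
        (by rw [e2]; exact pow_le_one₀ (by norm_num) (by norm_num)) g
      refine h.trans ?_
      rw [e2, mul_add]
      have : 0 ≤ ((2 : ℝ)⁻¹ ^ j.natAbs) ^ K * (C₁ * SchwartzMap.seminorm ℂ 0 (m + K) g) := by
        positivity
      linarith
    · have e2 : (2 : ℝ) ^ (-j) = ((2 : ℝ)⁻¹ ^ j.natAbs)⁻¹ := by
        rw [inv_pow, inv_inv, ← zpow_natCast, Int.natCast_natAbs, abs_of_nonpos hj]
      have h := h₁ ((2 : ℝ) ^ (-j))
        (by rw [e2]; exact (one_le_inv₀ (by positivity)).2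
              (pow_le_one₀ (by norm_num) (by norm_num))) g (fun i _ => hg i)
      refine h.trans ?_
      rw [e2, mul_add, inv_inv, Nat.add_sub_cancel_left]
      have : 0 ≤ ((2 : ℝ)⁻¹ ^ j.natAbs) ^ K *
        (C₂ * ∑ l ∈ Finset.range (m + 1), SchwartzMap.seminorm ℂ (k + K) l g) := by positivity
      linarith

theorem summable_pow_natAbs {r : ℝ} (h0 : 0 ≤ r) (h1 : r < 1) :
    Summable fun j : ℤ => r ^ j.natAbs := by
  refine Summable.of_nat_of_neg ?_ ?_ <;> simpa using summable_geometric_of_lt_one h0 h1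

/-- A series of Schwartz functions which converges absolutely with respect to all seminorms,
converges to its pointwise sum. -/
theorem hasSum_of_summable_seminorm {ι : Type*} {u : ι → 𝓢(E, ℂ)} {g : 𝓢(E, ℂ)}
    (hu : ∀ k m, Summable fun j => SchwartzMap.seminorm ℂ k m (u j))
    (hg : ∀ x, HasSum (fun j => u j x) (g x)) : HasSum u g := by
  have hder : ∀ m x, HasSum (fun j => iteratedFDeriv ℝ m (u j) x) (iteratedFDeriv ℝ m g x) := by
    intro m x
    have hsm : Summable fun j => iteratedFDeriv ℝ m (u j) x :=
      Summable.of_norm_bounded (hu 0 m)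
        fun j => SchwartzMap.norm_iteratedFDeriv_le_seminorm ℂ (u j) m x
    have h1 := iteratedFDeriv_tsum_apply (𝕜 := ℝ) (f := fun j => (u j : E → ℂ)) (N := m)
      (v := fun l j => SchwartzMap.seminorm ℂ 0 l (u j)) (fun j => (u j).smooth m)
      (fun l _ => hu 0 l)
      (fun l j x _ => SchwartzMap.norm_iteratedFDeriv_le_seminorm ℂ (u j) l x) (k := m) le_rfl x
    rw [show (fun y => ∑' j, u j y) = g from funext fun y => (hg y).tsum_eq] at h1
    rw [h1]
    exact hsm.hasSum
  rw [HasSum, (schwartz_withSeminorms ℂ E ℂ).tendsto_nhds]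
  rintro ⟨k, m⟩ ε hε
  -- The remainder of the series is bounded, uniformly in `x`, by the tail of the summable series of
  -- seminorms.
  have htail := tendsto_tsum_compl_atTop_zero fun j => SchwartzMap.seminorm ℂ k m (u j)
  filter_upwards [htail.eventually_lt_const hε] with t ht
  refine lt_of_le_of_lt ?_ ht
  refine SchwartzMap.seminorm_le_bound ℂ k m _ (tsum_nonneg fun _ => apply_nonneg _ _) fun x => ?_
  have e : iteratedFDeriv ℝ m (∑ j ∈ t, u j - g : 𝓢(E, ℂ)) x =
      -∑' j : {j // j ∉ t}, iteratedFDeriv ℝ m (u j) x := by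
    have h2 := (hder m x).summable.sum_add_tsum_subtype_compl t
    rw [(hder m x).tsum_eq] at h2
    have h3 : iteratedFDeriv ℝ m (∑ j ∈ t, u j - g : 𝓢(E, ℂ)) x =
        ∑ j ∈ t, iteratedFDeriv ℝ m (u j) x - iteratedFDeriv ℝ m g x := by
      have e1 : ((∑ j ∈ t, u j - g : 𝓢(E, ℂ)) : E → ℂ) =
          (fun x => ∑ j ∈ t, u j x) - (g : E → ℂ) := by
        ext y; simp
      rw [e1, iteratedFDeriv_sub_apply
        (ContDiff.sum fun j _ => (u j).smooth m).contDiffAt (g.smooth m).contDiffAt,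
        iteratedFDeriv_fun_sum_apply (fun j _ => ((u j).smooth m).contDiffAt)]
    rw [h3, ← h2]
    abel
  rw [e, norm_neg]
  have hs : Summable fun j : {j // j ∉ t} => SchwartzMap.seminorm ℂ k m (u j) :=
    (hu k m).subtype _
  have hs0 : Summable fun j : {j // j ∉ t} => ‖iteratedFDeriv ℝ m (u j) x‖ :=
    Summable.of_nonneg_of_le (fun _ => norm_nonneg _)
      (fun j => SchwartzMap.norm_iteratedFDeriv_le_seminorm ℂ (u j) m x) ((hu 0 m).subtype _)
  calc _ ≤ ‖x‖ ^ k * ∑' j : {j // j ∉ t}, ‖iteratedFDeriv ℝ m (u j) x‖ := by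
        gcongr; exact norm_tsum_le_tsum_norm hs0
    _ = ∑' j : {j // j ∉ t}, ‖x‖ ^ k * ‖iteratedFDeriv ℝ m (u j) x‖ := tsum_mul_left.symm
    _ ≤ _ := (hs0.mul_left _).tsum_le_tsum
        (fun j => SchwartzMap.le_seminorm ℂ k m (u j) x) hs

end Flat

/-! ### Moments, flatness, and distributions vanishing on `𝓢_∞`. -/

/-- The monomial `∏ i, x (σ i)`. -/
def monomialOf {k : ℕ} (σ : Fin k → Fin n) : MvPolynomial (Fin n) ℂ :=
  ∏ i, MvPolynomial.X (σ i)

/-- The derivatives of `𝓕⁻ ψ` at the origin are determined by the moments of `ψ`. -/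
theorem iteratedFDeriv_fourierInv_zero {ψ : 𝓢(Rn n, ℂ)} {k : ℕ}
    (h : ∀ σ : Fin k → Fin n, polyDistribution n (monomialOf σ) ψ = 0) :
    iteratedFDeriv ℝ k (𝓕⁻ ψ : 𝓢(Rn n, ℂ)) 0 = 0 := by
  have e1 : ((𝓕⁻ ψ : 𝓢(Rn n, ℂ)) : Rn n → ℂ) = fun x => (𝓕 (ψ : Rn n → ℂ)) ((-1 : ℝ) • x) := by
    ext x
    rw [SchwartzMap.fourierInv_coe, Real.fourierInv_eq_fourier_neg, neg_one_smul]
  have hint : ∀ l : ℕ, Integrable fun v => ‖v‖ ^ l * ‖ψ v‖ := fun l => ψ.integrable_pow_mul volume l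
  have hsm : ContDiff ℝ k (𝓕 (ψ : Rn n → ℂ)) := by
    rw [← SchwartzMap.fourier_coe]; exact (𝓕 ψ).smooth k
  rw [e1, iteratedFDeriv_comp_const_smul _ hsm]
  simp only [smul_zero]
  have hder : iteratedFDeriv ℝ k (𝓕 (ψ : Rn n → ℂ)) 0 = 0 := by
    rw [Real.iteratedFDeriv_fourier (N := ⊤) (fun l _ => hint l)
      ψ.continuous.aestronglyMeasurable le_top]
    have hI : Integrable fun v => VectorFourier.fourierPowSMulRight (innerSL ℝ) (ψ : Rn n → ℂ) v k := by
      refine VectorFourier.integrable_fourierPowSMulRight _ (hint k)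
        ψ.continuous.aestronglyMeasurable
    -- A multilinear map is determined on tuples of basis vectors. At frequency zero the exponential
    -- is `1`, so each such value is a constant times a moment that vanishes by `h`.
    apply ContinuousMultilinearMap.toMultilinearMap_injective
    refine Module.Basis.ext_multilinear (fun _ => (EuclideanSpace.basisFun (Fin n) ℝ).toBasis)
      fun σ => ?_
    have h1 := h σ
    rw [polyDistribution_apply] at h1
    rw [Real.fourier_eq]
    simp only [inner_zero_right, neg_zero, AddChar.map_zero_eq_one, one_smul]
    rw [ContinuousMultilinearMap.coe_coe, ContinuousMultilinearMap.integral_apply hI]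
    simp only [VectorFourier.fourierPowSMulRight_apply]
    rw [integral_smul]
    have e2 : ∀ v : Rn n, (∏ i, (innerSL ℝ v) ((EuclideanSpace.basisFun (Fin n) ℝ).toBasis (σ i))) •
        ψ v = ψ v • polyFun (monomialOf σ) v := by
      intro v
      simp [polyFun, monomialOf, EuclideanSpace.inner_single_right, mul_comm]
    simp only [e2, h1]
    simp
  rw [hder, smul_zero]

/-- The inverse Fourier transform of an element of `𝓢_∞` vanishes to infinite order at the
origin. -/
theorem iteratedFDeriv_fourierInv_zero_of_mem_SInf {ψ : 𝓢(Rn n, ℂ)} (hψ : ψ ∈ SInf n) (k : ℕ) :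
    iteratedFDeriv ℝ k (𝓕⁻ ψ : 𝓢(Rn n, ℂ)) 0 = 0 := by
  refine iteratedFDeriv_fourierInv_zero fun σ => ?_
  have h := polynomials_le_ker_restrictSInf (n := n) ⟨monomialOf σ, rfl⟩
  rw [LinearMap.mem_ker] at h
  exact DFunLike.congr_fun h (⟨ψ, hψ⟩ : SInf n)

/-- The Fourier transform of a function which vanishes near the origin belongs to `𝓢_∞`. -/
theorem fourier_mem_SInf {g : 𝓢(Rn n, ℂ)} (hg : ∀ᶠ x in nhds (0 : Rn n), g x = 0) :
    𝓕 g ∈ SInf n := by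
  intro α
  have h := integral_fourier_mul_polyFun (MvPolynomial.monomial α 1) hg
  simpa [polyFun, MvPolynomial.eval_monomial, Finsupp.prod_fintype] using h

/-- A smooth compactly supported cut-off function that equals one near the origin. -/
theorem exists_schwartz_bump (E : Type*) [NormedAddCommGroup E] [NormedSpace ℝ E]
    [HasContDiffBump E] [FiniteDimensional ℝ E] :
    ∃ θ : 𝓢(E, ℂ), tsupport θ ⊆ Metric.closedBall 0 2 ∧ ∀ x, ‖x‖ ≤ 1 → θ x = 1 := by
  let b : ContDiffBump (0 : E) := ⟨1, 2, one_pos, one_lt_two⟩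
  have hs : HasCompactSupport fun x : E => ((b x : ℝ) : ℂ) :=
    b.hasCompactSupport.comp_left Complex.ofReal_zero
  have hd : ContDiff ℝ (⊤ : ℕ∞) fun x : E => ((b x : ℝ) : ℂ) :=
    Complex.ofRealCLM.contDiff.comp b.contDiff
  refine ⟨hs.toSchwartzMap hd, ?_, fun x hx => ?_⟩
  · refine (tsupport_comp_subset (f := b) (g := ((↑) : ℝ → ℂ)) Complex.ofReal_zero).trans ?_
    rw [b.tsupport_eq]
  · simp [b.one_of_mem_closedBall (x := x) (by simpa [b] using hx)]

/-- A continuous functional on `𝓢` that vanishes on all functions vanishing near the origin also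
vanishes on all functions that are flat of some finite order at the origin. -/
theorem exists_order_of_forall_eventually_eq_zero {E : Type*} [NormedAddCommGroup E]
    [NormedSpace ℝ E] [HasContDiffBump E] [FiniteDimensional ℝ E] (T : 𝓢(E, ℂ) →L[ℂ] ℂ)
    (hT : ∀ g : 𝓢(E, ℂ), (∀ᶠ x in nhds (0 : E), g x = 0) → T g = 0) :
    ∃ N : ℕ, ∀ g : 𝓢(E, ℂ), (∀ i < N, iteratedFDeriv ℝ i g 0 = 0) → T g = 0 := by
  obtain ⟨θ, hθ, hθ1⟩ := exists_schwartz_bump E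
  obtain ⟨s, C, -, hC⟩ := Seminorm.bound_of_continuous (schwartz_withSeminorms ℂ E ℂ)
    ((normSeminorm ℂ ℂ).comp T.toLinearMap) (by exact T.continuous.norm)
  -- One more than every derivative order in the bound for `T`, so that each exponent `N - i.2` is
  -- positive and the powers of `c⁻¹` tend to zero.
  set N := s.sup Prod.snd + 1
  refine ⟨N, fun g hg => ?_⟩
  -- `θ (c • ·)` equals one near the origin, so `T` cannot distinguish `g` from its cut-off at any
  -- scale.
  have hcut : ∀ c : ℝ, 0 < c → T (cutoff θ c g) = T g := by
    intro c hc
    rw [← sub_eq_zero, ← map_sub]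
    refine hT _ ?_
    have hev : ∀ᶠ x in nhds (0 : E), ‖c • x‖ < 1 := by
      have : Continuous fun x : E => ‖c • x‖ := by fun_prop
      exact this.continuousAt.eventually_lt_const (by simp)
    filter_upwards [hev] with x hx
    simp [cutoff_apply, hθ1 _ hx.le]
  have hlim : ∀ i ∈ s, Filter.Tendsto
      (fun c : ℝ => SchwartzMap.seminorm ℂ i.1 i.2 (cutoff θ c g)) Filter.atTop (nhds 0) := by
    intro i hi
    have hiN : i.2 < N := Nat.lt_succ_of_le (Finset.le_sup (f := Prod.snd) hi)
    obtain ⟨D, -, hD⟩ := exists_seminorm_cutoff_le_of_one_le θ hθ i.1 hiN.le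
    refine squeeze_zero' (Filter.Eventually.of_forall fun c => apply_nonneg _ _)
      ((Filter.eventually_ge_atTop 1).mono fun c hc => hD c hc g hg) ?_
    have h0 : Filter.Tendsto (fun c : ℝ => (c⁻¹) ^ (N - i.2)) Filter.atTop (nhds 0) := by
      have := (tendsto_inv_atTop_zero (𝕜 := ℝ)).pow (N - i.2)
      rwa [zero_pow (by omega)] at this
    simpa using (h0.const_mul D).mul_const (SchwartzMap.seminorm ℂ 0 N g)
  have hsum : Filter.Tendsto (fun c : ℝ => (C : ℝ) *
      ∑ i ∈ s, SchwartzMap.seminorm ℂ i.1 i.2 (cutoff θ c g)) Filter.atTop (nhds 0) := by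
    simpa using (tendsto_finsetSum s hlim).const_mul (C : ℝ)
  have hle : ‖T g‖ ≤ 0 := by
    refine ge_of_tendsto hsum ((Filter.eventually_gt_atTop 0).mono fun c hc => ?_)
    have h1 := hC (cutoff θ c g)
    have h2 : s.sup (schwartzSeminormFamily ℂ E ℂ) (cutoff θ c g) ≤
        ∑ i ∈ s, SchwartzMap.seminorm ℂ i.1 i.2 (cutoff θ c g) := by
      simpa using! Seminorm.finset_sup_le_sum (schwartzSeminormFamily ℂ E ℂ) s (cutoff θ c g)
    calc ‖T g‖ = ‖T (cutoff θ c g)‖ := by rw [hcut c hc]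
      _ ≤ C * s.sup (schwartzSeminormFamily ℂ E ℂ) (cutoff θ c g) := h1
      _ ≤ _ := by gcongr
  exact norm_le_zero_iff.1 hle

/-- A tempered distribution which vanishes on `𝓢_∞` is a polynomial. -/
theorem mem_polynomials_of_restrictSInf_eq_zero {f : 𝓢'(Rn n, ℂ)} (hf : restrictSInf n f = 0) :
    f ∈ polynomials n := by
  let T : 𝓢(Rn n, ℂ) →L[ℂ] ℂ :=
    { toLinearMap := (f : 𝓢(Rn n, ℂ) →ₗ[ℂ] ℂ) ∘ₗ
        (FourierTransform.fourierCLM ℂ 𝓢(Rn n, ℂ) : 𝓢(Rn n, ℂ) →ₗ[ℂ] 𝓢(Rn n, ℂ))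
      cont := (map_continuous f).comp (FourierTransform.fourierCLM ℂ 𝓢(Rn n, ℂ)).continuous }
  have hTf : ∀ g, T g = f (𝓕 g) := fun g => rfl
  obtain ⟨N, hN⟩ := exists_order_of_forall_eventually_eq_zero T fun g hg =>
    DFunLike.congr_fun hf (⟨𝓕 g, fourier_mem_SInf hg⟩ : SInf n)
  -- Monomials repeat in this family, which is harmless: only finiteness matters, since a functional
  -- vanishing on the common kernel of finitely many others lies in their span.
  let L : (Σ k : Fin N, Fin k → Fin n) → 𝓢(Rn n, ℂ) →ₗ[ℂ] ℂ := fun i =>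
    (polyDistribution n (monomialOf i.2) : 𝓢(Rn n, ℂ) →ₗ[ℂ] ℂ)
  have hspan : (f : 𝓢(Rn n, ℂ) →ₗ[ℂ] ℂ) ∈ Submodule.span ℂ (Set.range L) := by
    refine mem_span_of_iInf_ker_le_ker fun ψ hψ => ?_
    rw [Submodule.mem_iInf] at hψ
    rw [LinearMap.mem_ker]
    have h1 := hN (𝓕⁻ ψ) fun k hk => iteratedFDeriv_fourierInv_zero fun σ => hψ ⟨⟨k, hk⟩, σ⟩
    rw [hTf, FourierTransform.fourier_fourierInv_eq] at h1
    exact h1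
  obtain ⟨c, hc⟩ := (Submodule.mem_span_range_iff_exists_fun ℂ).1 hspan
  refine ⟨∑ i, c i • monomialOf i.2, ?_⟩
  ext ψ
  have h2 := LinearMap.congr_fun hc ψ
  simp only [LinearMap.sum_apply, LinearMap.smul_apply, L] at h2
  refine Eq.trans ?_ h2
  rw [map_sum]
  simp [map_smul]

theorem toSInfDual_injective : Function.Injective (toSInfDual n) := by
  rw [injective_iff_map_eq_zero]
  intro F hF
  induction F using Submodule.Quotient.induction_on with
  | H f =>
    rw [Submodule.Quotient.mk_eq_zero]
    exact mem_polynomials_of_restrictSInf_eq_zero hF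

/-! ### The reproducing formula and the dual generator. -/

/-- A Calderón-type reproducing formula: if the dyadic dilates of a smooth function `a`, supported
in an annulus, have no common zero except the origin, then there is a smooth `χ` supported in the
same annulus with `∑ j, χ (2⁻ʲ x) a (2⁻ʲ x) = 1` for `x ≠ 0`. -/
theorem exists_dyadic_resolution {E : Type*} [NormedAddCommGroup E] [NormedSpace ℝ E]
    {a : E → ℝ} (hsm : ContDiff ℝ (⊤ : ℕ∞) a) {r R : ℝ} (hr : 0 < r)
    (har : ∀ x, ‖x‖ < r → a x = 0) (haR : ∀ x, R < ‖x‖ → a x = 0)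
    (hne : ∀ x ≠ 0, ∃ k : ℤ, a ((2 : ℝ) ^ k • x) ≠ 0) :
    ∃ χ : E → ℝ, ContDiff ℝ (⊤ : ℕ∞) χ ∧ tsupport χ ⊆ tsupport a ∧
      ∀ x ≠ 0, HasSum (fun j : ℤ => χ ((2 : ℝ) ^ (-j) • x) * a ((2 : ℝ) ^ (-j) • x)) 1 := by
  have hts : ∀ x ∈ tsupport a, r ≤ ‖x‖ ∧ ‖x‖ ≤ R := by
    intro x hx
    have hcl : IsClosed {x : E | r ≤ ‖x‖ ∧ ‖x‖ ≤ R} :=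
      (isClosed_le continuous_const continuous_norm).inter
        (isClosed_le continuous_norm continuous_const)
    refine closure_minimal (fun y hy => ?_) hcl hx
    exact ⟨not_lt.1 fun h => hy (har y h), not_lt.1 fun h => hy (haR y h)⟩
  -- The annulus has ratio `R / r < 2 ^ N`, so two points of one dyadic orbit in it differ by at
  -- most `N` steps.
  obtain ⟨N, hN⟩ := pow_unbounded_of_one_lt (R / r) (one_lt_two (α := ℝ))
  have hwin : ∀ y ∈ tsupport a, ∀ k : ℤ, a ((2 : ℝ) ^ k • y) ≠ 0 →
      k ∈ Finset.Icc (-N : ℤ) N := by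
    intro y hy k hk
    obtain ⟨h1, h2⟩ := hts y hy
    obtain ⟨h3, h4⟩ := hts _ (subset_tsupport a hk)
    rw [norm_smul, Real.norm_of_nonneg (by positivity)] at h3 h4
    have hy0 : 0 < ‖y‖ := hr.trans_le h1
    have h5 : R < 2 ^ N * r := by rwa [div_lt_iff₀ hr] at hN
    have h2N : (0 : ℝ) < 2 ^ N := by positivity
    have h2k : (0 : ℝ) < 2 ^ k := by positivity
    rw [Finset.mem_Icc]
    constructor
    · by_contra hlt
      have h6 : (2 : ℝ) ^ k ≤ 2 ^ (-(N : ℤ)) := zpow_le_zpow_right₀ one_le_two (by omega)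
      rw [zpow_neg, zpow_natCast] at h6
      have h7 : (2 : ℝ) ^ N * 2 ^ k ≤ 1 := by
        calc (2 : ℝ) ^ N * 2 ^ k ≤ 2 ^ N * (2 ^ N)⁻¹ := by gcongr
          _ = 1 := mul_inv_cancel₀ h2N.ne'
      have h8 : 2 ^ N * r ≤ 2 ^ N * 2 ^ k * ‖y‖ := by rw [mul_assoc]; gcongr
      nlinarith
    · by_contra hlt
      have h6 : (2 : ℝ) ^ (N : ℤ) ≤ 2 ^ k := zpow_le_zpow_right₀ one_le_two (by omega)
      rw [zpow_natCast] at h6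
      have : 2 ^ N * r ≤ 2 ^ k * ‖y‖ := by gcongr
      linarith
  -- The finite window makes `D` smooth everywhere. On `tsupport a` it captures every nonzero term
  -- of the sum of squares over the orbit and is positive by `hne`.
  set D : E → ℝ := fun y => ∑ k ∈ Finset.Icc (-N : ℤ) N, a ((2 : ℝ) ^ k • y) ^ 2 with hD
  have hDpos : ∀ y ∈ tsupport a, D y ≠ 0 := by
    intro y hy
    obtain ⟨k, hk⟩ := hne y (norm_pos_iff.1 (hr.trans_le (hts y hy).1))
    exact (Finset.sum_pos' (fun i _ => sq_nonneg _) ⟨k, hwin y hy k hk, by positivity⟩).ne'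
  have hDsm : ContDiff ℝ (⊤ : ℕ∞) D :=
    ContDiff.sum fun k _ => (hsm.comp (contDiff_const_smul _)).pow 2
  refine ⟨fun y => a y / D y, ?_, ?_, fun x hx => ?_⟩
  · rw [contDiff_iff_contDiffAt]
    intro y
    by_cases hy : y ∈ tsupport a
    · exact hsm.contDiffAt.div hDsm.contDiffAt (hDpos y hy)
    · have h0 : (fun y => a y / D y) =ᶠ[nhds y] fun _ => 0 := by
        filter_upwards [notMem_tsupport_iff_eventuallyEq.1 hy] with z hz
        simp [hz]
      exact contDiffAt_const.congr_of_eventuallyEq h0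
  · refine closure_mono fun y hy h => hy ?_
    simp [h]
  -- At each orbit point where `a` is nonzero, `D` is the full orbit sum. It is thus the same number
  -- at all of them, and normalizes the sum of squares to one.
  · have hsum : ∀ j : ℤ, a ((2 : ℝ) ^ (-j) • x) ≠ 0 →
        HasSum (fun i : ℤ => a ((2 : ℝ) ^ (-i) • x) ^ 2) (D ((2 : ℝ) ^ (-j) • x)) := by
      intro j hj
      rw [← (Equiv.subLeft j).hasSum_iff]
      have e : (fun i : ℤ => a ((2 : ℝ) ^ (-i) • x) ^ 2) ∘ (Equiv.subLeft j) =
          fun k => a ((2 : ℝ) ^ k • (2 : ℝ) ^ (-j) • x) ^ 2 := by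
        ext k
        simp only [Function.comp_apply, Equiv.subLeft_apply]
        rw [smul_smul, ← zpow_add₀ two_ne_zero, neg_sub, sub_eq_add_neg]
      rw [e]
      refine hasSum_sum_of_ne_finset_zero fun k hk => ?_
      by_contra h
      exact hk (hwin _ (subset_tsupport a hj) k fun h0 => h (by rw [h0, zero_pow two_ne_zero]))
    obtain ⟨k, hk⟩ := hne x hx
    have hj₀ : a ((2 : ℝ) ^ (-(-k)) • x) ≠ 0 := by rwa [neg_neg]
    have hS := hsum _ hj₀
    have h1 := hS.div_const (D ((2 : ℝ) ^ (-(-k)) • x))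
    rw [div_self (hDpos _ (subset_tsupport a hj₀))] at h1
    refine h1.congr_fun fun j => ?_
    by_cases hj : a ((2 : ℝ) ^ (-j) • x) = 0
    · simp only [hj, mul_zero, zero_pow two_ne_zero, zero_div]
    · rw [← (hsum j hj).unique hS]
      ring

namespace DyadicGenerator

variable (φ : DyadicGenerator n)

theorem eq_zero_of_le_norm {ξ : Rn n} (hξ : 8 ≤ ‖ξ‖) : φ.toSchwartz ξ = 0 := by
  rcases φ.admissible with h | ⟨ψ, hψ, h⟩
  · obtain ⟨h1, h2⟩ := h ξ
    rw [Set.indicator_of_notMem (by simp; intros; linarith)] at h1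
    rw [Set.indicator_of_notMem (by simp; intros; linarith)] at h2
    exact le_antisymm h2 h1
  · have key : ∀ η : Rn n, 2 ≤ ‖η‖ → ψ η = 0 := by
      intro η hη
      obtain ⟨h1, h2⟩ := hψ η
      rw [Set.indicator_of_notMem (by simp; linarith)] at h1
      rw [Set.indicator_of_notMem (by simp; linarith)] at h2
      exact le_antisymm h2 h1
    rw [h, key ξ (by linarith), key ((2 : ℝ) • ξ) (by rw [norm_smul]; norm_num; linarith), sub_self]

/-- Every dyadic orbit has a point with norm in `[2, 4)`, where `φ ≥ 1` in the first admissible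
case. In the second, vanishing of `φ` along the orbit would make `ψ` constant there, although `ψ` is
`1` at norm in `[1/2, 1)` and `0` two steps further out. -/
theorem exists_dilation_ne_zero {ξ : Rn n} (hξ : ξ ≠ 0) :
    ∃ k : ℤ, φ.toSchwartz ((2 : ℝ) ^ k • ξ) ≠ 0 := by
  have hξ0 : 0 < ‖ξ‖ := norm_pos_iff.2 hξ
  obtain ⟨m, hm1, hm2⟩ := exists_mem_Ico_zpow hξ0 one_lt_two
  have hnorm : ∀ k : ℤ, ‖(2 : ℝ) ^ k • ξ‖ = 2 ^ k * ‖ξ‖ := fun k => by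
    rw [norm_smul, Real.norm_of_nonneg (by positivity)]
  have hlow : ∀ k : ℤ, (2 : ℝ) ^ k ≤ ‖(2 : ℝ) ^ (k - m) • ξ‖ := fun k => by
    rw [hnorm]
    calc (2 : ℝ) ^ k = 2 ^ (k - m) * 2 ^ m := by rw [← zpow_add₀ two_ne_zero, sub_add_cancel]
      _ ≤ _ := by gcongr
  have hupp : ∀ k : ℤ, ‖(2 : ℝ) ^ (k - m) • ξ‖ < 2 ^ (k + 1) := fun k => by
    rw [hnorm]
    calc _ < (2 : ℝ) ^ (k - m) * 2 ^ (m + 1) := by gcongr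
      _ = _ := by rw [← zpow_add₀ two_ne_zero]; congr 1; ring
  rcases φ.admissible with h | ⟨ψ, hψ, h⟩
  · refine ⟨1 - m, ?_⟩
    have h1 := (h ((2 : ℝ) ^ (1 - m) • ξ)).1
    have h2 := hlow 1
    have h3 := hupp 1
    norm_num at h2 h3
    rw [Set.indicator_of_mem (by simp only [Set.mem_sdiff, mem_ball_zero_iff]; constructor <;> linarith)] at h1
    linarith
  · by_contra! hall
    have h1 : ψ ((2 : ℝ) ^ (-1 - m) • ξ) = 1 := by
      have h3 := hupp (-1)
      norm_num at h3
      obtain ⟨h1, h2⟩ := hψ ((2 : ℝ) ^ (-1 - m) • ξ)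
      rw [Set.indicator_of_mem (by rw [mem_ball_zero_iff]; linarith)] at h1
      rw [Set.indicator_of_mem (by rw [mem_ball_zero_iff]; linarith)] at h2
      exact le_antisymm h2 h1
    have h2 : ψ ((2 : ℝ) ^ (1 - m) • ξ) = 0 := by
      have h3 := hlow 1
      norm_num at h3
      obtain ⟨h1, h2⟩ := hψ ((2 : ℝ) ^ (1 - m) • ξ)
      rw [Set.indicator_of_notMem (by rw [mem_ball_zero_iff]; linarith)] at h1
      rw [Set.indicator_of_notMem (by rw [mem_ball_zero_iff]; linarith)] at h2
      exact le_antisymm h2 h1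
    have hstep : ∀ k : ℤ, ψ ((2 : ℝ) ^ k • ξ) = ψ ((2 : ℝ) ^ (k + 1) • ξ) := fun k => by
      have := hall k
      rw [h, smul_smul, sub_eq_zero] at this
      rw [this, zpow_add_one₀ two_ne_zero, mul_comm]
    have h3 := hstep (-1 - m)
    have h4 := hstep (-1 - m + 1)
    rw [show -1 - m + 1 + 1 = 1 - m by ring] at h4
    rw [h1, h4, h2] at h3
    exact one_ne_zero h3

theorem symbol_zero_zpow (j : ℤ) (η : Rn n) :
    φ.symbol j η = φ.symbol 0 ((2 : ℝ) ^ (-j) • η) := by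
  simp only [symbol, neg_zero, zpow_zero, one_smul]
  rw [smul_comm]

theorem symbol_eventually_eq_zero (j : ℤ) : ∀ᶠ η in nhds (0 : Rn n), φ.symbol j η = 0 := by
  have hcont : Continuous fun η : Rn n => ‖(2 : ℝ) ^ (-j) • ((2 * Real.pi) • η)‖ := by fun_prop
  have hev : ∀ᶠ η in nhds (0 : Rn n), ‖(2 : ℝ) ^ (-j) • ((2 * Real.pi) • η)‖ < 1 / 2 :=
    hcont.continuousAt.eventually_lt_const (by simp)
  filter_upwards [hev] with η hη
  rw [symbol, φ.eq_zero_of_norm_lt hη, Complex.ofReal_zero]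

/-- A dual generator for the dyadic blocks. -/
theorem exists_dual : ∃ (χ : 𝓢(Rn n, ℂ)) (r R : ℝ), 0 < r ∧ (∀ x ∈ tsupport χ, r ≤ ‖x‖) ∧
    tsupport χ ⊆ Metric.closedBall 0 R ∧
    ∀ x ≠ 0, HasSum (fun j : ℤ => φ.symbol j x * χ ((2 : ℝ) ^ (-j) • x)) 1 := by
  -- The real form of `φ.symbol 0`; the radii `1/2` and `8` are divided by `2π`.
  set a : Rn n → ℝ := fun η => φ.toSchwartz ((2 * Real.pi) • η)
  have hpi : (0 : ℝ) < 2 * Real.pi := by positivity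
  have hnorm : ∀ η : Rn n, ‖(2 * Real.pi) • η‖ = 2 * Real.pi * ‖η‖ := fun η => by
    rw [norm_smul, Real.norm_of_nonneg hpi.le]
  have har : ∀ x, ‖x‖ < 1 / 2 / (2 * Real.pi) → a x = 0 := fun x hx => by
    refine φ.eq_zero_of_norm_lt ?_
    rwa [hnorm, ← lt_div_iff₀' hpi]
  have haR : ∀ x, 8 / (2 * Real.pi) < ‖x‖ → a x = 0 := fun x hx => by
    refine φ.eq_zero_of_le_norm ?_
    rw [hnorm, ← div_le_iff₀' hpi]
    exact hx.le
  obtain ⟨χ, hsm, hsupp, hsum⟩ := exists_dyadic_resolution (a := a)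
    ((φ.toSchwartz.smooth ⊤).comp (contDiff_const_smul _)) (by positivity) har haR fun x hx => by
      obtain ⟨k, hk⟩ := φ.exists_dilation_ne_zero (smul_ne_zero hpi.ne' hx)
      exact ⟨k, by rwa [smul_comm] at hk⟩
  have hts : tsupport χ ⊆ {x | 1 / 2 / (2 * Real.pi) ≤ ‖x‖ ∧ ‖x‖ ≤ 8 / (2 * Real.pi)} := by
    refine hsupp.trans (closure_minimal (fun y hy => ?_)
      ((isClosed_le continuous_const continuous_norm).inter
        (isClosed_le continuous_norm continuous_const)))
    exact ⟨not_lt.1 fun h => hy (har y h), not_lt.1 fun h => hy (haR y h)⟩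
  have hts' : tsupport (fun x => (χ x : ℂ)) ⊆ tsupport χ :=
    tsupport_comp_subset (f := χ) (g := ((↑) : ℝ → ℂ)) Complex.ofReal_zero
  have hball : tsupport (fun x => (χ x : ℂ)) ⊆ Metric.closedBall 0 (8 / (2 * Real.pi)) :=
    fun x hx => by simpa using (hts (hts' hx)).2
  have hcpt : HasCompactSupport fun x => (χ x : ℂ) :=
    (isCompact_closedBall _ _).of_isClosed_subset isClosed_closure hball
  refine ⟨hcpt.toSchwartzMap (Complex.ofRealCLM.contDiff.comp hsm), 1 / 2 / (2 * Real.pi),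
    8 / (2 * Real.pi), by positivity, fun x hx => (hts (hts' hx)).1, hball, fun x hx => ?_⟩
  have h1 := Complex.hasSum_ofReal.2 (hsum x hx)
  rw [Complex.ofReal_one] at h1
  refine h1.congr_fun fun j => ?_
  rw [Complex.ofReal_mul, mul_comm]
  simp only [symbol, a]
  rw [smul_comm]
  rfl

end DyadicGenerator

/-! ### The pairing with `𝓢_∞` is controlled by the dyadic blocks. -/

/-- Dyadic localizations of flat functions decay rapidly in every continuous seminorm. -/
theorem exists_continuous_seminorm_cutoff_le {E : Type*} [NormedAddCommGroup E] [NormedSpace ℝ E]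
    (a : 𝓢(E, ℂ)) {r R : ℝ} (hr : 0 < r) (ha : ∀ x ∈ tsupport a, r ≤ ‖x‖)
    (ha' : tsupport a ⊆ Metric.closedBall 0 R) (K : ℕ) {q : Seminorm ℂ 𝓢(E, ℂ)}
    (hq : Continuous q) :
    ∃ p : Seminorm ℂ 𝓢(E, ℂ), Continuous p ∧ ∀ (j : ℤ) (g : 𝓢(E, ℂ)),
      (∀ i, iteratedFDeriv ℝ i g 0 = 0) →
      q (cutoff a ((2 : ℝ) ^ (-j)) g) ≤ ((2 : ℝ)⁻¹ ^ K) ^ j.natAbs * p g := by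
  obtain ⟨t, C, -, hC⟩ := Seminorm.bound_of_continuous (schwartz_withSeminorms ℂ E ℂ) q hq
  choose p hp hpb using fun i : ℕ × ℕ => exists_seminorm_cutoff_zpow_le a hr ha ha' i.1 i.2 K
  have e : ((C • ∑ i ∈ t, p i : Seminorm ℂ 𝓢(E, ℂ)) : 𝓢(E, ℂ) → ℝ) =
      fun g => C * ∑ i ∈ t, p i g := by
    ext g
    simp [NNReal.smul_def]
  refine ⟨C • ∑ i ∈ t, p i, ?_, fun j g hg => ?_⟩
  · rw [e]
    fun_prop
  · rw [e]
    have h1 : t.sup (schwartzSeminormFamily ℂ E ℂ) (cutoff a ((2 : ℝ) ^ (-j)) g) ≤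
        ∑ i ∈ t, SchwartzMap.seminorm ℂ i.1 i.2 (cutoff a ((2 : ℝ) ^ (-j)) g) := by
      simpa using! Seminorm.finset_sup_le_sum (schwartzSeminormFamily ℂ E ℂ) t
        (cutoff a ((2 : ℝ) ^ (-j)) g)
    calc q (cutoff a ((2 : ℝ) ^ (-j)) g)
        ≤ C * t.sup (schwartzSeminormFamily ℂ E ℂ) (cutoff a ((2 : ℝ) ^ (-j)) g) := hC _
      _ ≤ C * ∑ i ∈ t, ((2 : ℝ)⁻¹ ^ K) ^ j.natAbs * p i g := by
          gcongr
          exact h1.trans (Finset.sum_le_sum fun i _ => hpb i j g hg)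
      _ = _ := by rw [← Finset.mul_sum]; ring

section Lp

variable (p : ℝ≥0∞) [Fact (1 ≤ p)]

/-- Hölder's inequality for the pairing of `L^p` with Schwartz functions. -/
theorem exists_seminorm_toTemperedDistribution_le :
    ∃ Q : Seminorm ℂ 𝓢(Rn n, ℂ), Continuous Q ∧
      ∀ (u : Lp ℂ p (volume : Measure (Rn n))) (ψ : 𝓢(Rn n, ℂ)),
        ‖Lp.toTemperedDistribution u ψ‖ ≤ ‖u‖ * Q ψ := by
  -- In `ℝ≥0∞` this formula for the conjugate exponent also covers `p = 1` (giving `∞`) and `p = ∞`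
  -- (giving `1`).
  have hpq : ENNReal.HolderConjugate p (1 - p⁻¹)⁻¹ :=
    ENNReal.HolderConjugate.inv_one_sub_inv' Fact.out
  have : Fact (1 ≤ (1 - p⁻¹)⁻¹) := by simp [fact_iff]
  set B := (ContinuousLinearMap.lsmul ℂ ℂ (E := ℂ)).flip.lpPairing
    (volume : Measure (Rn n)) p (1 - p⁻¹)⁻¹
  set J := SchwartzMap.toLpCLM ℂ ℂ (1 - p⁻¹)⁻¹ (volume : Measure (Rn n))
  refine ⟨‖B‖₊ • (normSeminorm ℂ _).comp J.toLinearMap, ?_, fun u ψ => ?_⟩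
  · exact (J.continuous.norm.const_smul ‖B‖₊)
  · calc ‖Lp.toTemperedDistribution u ψ‖ = ‖B u (J ψ)‖ := rfl
      _ ≤ ‖B‖ * ‖u‖ * ‖J ψ‖ := B.le_opNorm₂ u (J ψ)
      _ = ‖u‖ * (‖B‖ * ‖J ψ‖) := by ring
      _ = _ := rfl

variable {p}

/-- `L^p` embeds injectively into `𝓢'`, so the infimum runs over the single function `u`. -/
theorem lpENorm_toTemperedDistribution (u : Lp ℂ p (volume : Measure (Rn n))) :
    lpENorm p (Lp.toTemperedDistribution u) = ‖u‖ₑ := by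
  refine le_antisymm
    (iInf₂_le (f := fun (v : Lp ℂ p (volume : Measure (Rn n))) (_ : Lp.toTemperedDistribution v =
      Lp.toTemperedDistribution u) => ‖v‖ₑ) u rfl) (le_iInf₂ fun v hv => ?_)
  have hinj : Function.Injective
      (Lp.toTemperedDistributionCLM ℂ (volume : Measure (Rn n)) p) :=
    LinearMap.ker_eq_bot.1 Lp.ker_toTemperedDistributionCLM_eq_bot
  rw [hinj hv]

theorem exists_toTemperedDistribution_eq {g : 𝓢'(Rn n, ℂ)} (hg : lpENorm p g ≠ ∞) :
    ∃ u : Lp ℂ p (volume : Measure (Rn n)), Lp.toTemperedDistribution u = g := by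
  by_contra! h
  exact hg (by simp [lpENorm, h])

end Lp

theorem DyadicGenerator.block_apply (φ : DyadicGenerator n) (j : ℤ) (f : 𝓢'(Rn n, ℂ))
    (ψ : 𝓢(Rn n, ℂ)) :
    φ.block j f ψ = f (𝓕 (SchwartzMap.smulLeftCLM ℂ (φ.symbol j) (𝓕⁻ ψ))) := rfl

/-- A tempered distribution is controlled on `𝓢_∞` by its dyadic blocks. -/
theorem DyadicGenerator.exists_seminorm_apply_le (φ : DyadicGenerator n) (s : ℝ) (p : ℝ≥0∞)
    [Fact (1 ≤ p)] :
    ∃ P : Seminorm ℂ 𝓢(Rn n, ℂ), Continuous P ∧ ∀ (f : 𝓢'(Rn n, ℂ)) (M : ℝ), 0 ≤ M →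
      (∀ j : ℤ, lpENorm p (φ.block j f) ≤ ENNReal.ofReal (2 ^ (-(j * s)) * M)) →
      ∀ ψ ∈ SInf n, ‖f ψ‖ ≤ M * P ψ := by
  obtain ⟨χ, r, R, hr, hχr, hχR, hχ⟩ := φ.exists_dual
  obtain ⟨Q, hQ, hQb⟩ := exists_seminorm_toTemperedDistribution_le (n := n) p
  let 𝓕L := FourierTransform.fourierCLM ℂ 𝓢(Rn n, ℂ)
  let 𝓕I := FourierTransform.fourierInvCLM ℂ 𝓢(Rn n, ℂ)
  -- `⌈|s|⌉₊` powers of `2^{-|j|}` absorb the factor `2^{-js}`; the extra one makes the series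
  -- summable.
  set K := ⌈|s|⌉₊ + 1
  obtain ⟨q, hq, hqb⟩ := exists_continuous_seminorm_cutoff_le χ hr hχr hχR K
    (q := Q.comp 𝓕L.toLinearMap) (hQ.comp 𝓕L.continuous)
  set S : ℝ := ∑' j : ℤ, (2 : ℝ)⁻¹ ^ j.natAbs
  have hsumm : Summable fun j : ℤ => (2 : ℝ)⁻¹ ^ j.natAbs :=
    summable_pow_natAbs (by norm_num) (by norm_num)
  have hS : 0 ≤ S := tsum_nonneg fun j => by positivity
  have e : ((S.toNNReal • q.comp 𝓕I.toLinearMap : Seminorm ℂ 𝓢(Rn n, ℂ)) : 𝓢(Rn n, ℂ) → ℝ) =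
      fun ψ => S * q (𝓕⁻ ψ) := by
    ext ψ
    change S.toNNReal • q (𝓕⁻ ψ) = _
    rw [NNReal.smul_def, Real.coe_toNNReal _ hS, smul_eq_mul]
  refine ⟨S.toNNReal • q.comp 𝓕I.toLinearMap, ?_, fun f M hM hf ψ hψ => ?_⟩
  · rw [e]
    exact (hq.comp 𝓕I.continuous).const_mul S
  rw [e]
  set g := 𝓕⁻ ψ
  have hflat : ∀ i, iteratedFDeriv ℝ i g 0 = 0 := iteratedFDeriv_fourierInv_zero_of_mem_SInf hψ
  -- Its dilates `φ_j χ_j` resolve the identity off the origin; at the origin nothing is lost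
  -- because `g 0 = 0`.
  set b : 𝓢(Rn n, ℂ) := SchwartzMap.smulLeftCLM ℂ (φ.symbol 0) χ
  have hb : ∀ x, b x = φ.symbol 0 x * χ x := fun x => by
    rw [SchwartzMap.smulLeftCLM_apply_apply (φ.symbol_hasTemperateGrowth 0), smul_eq_mul]
  have hbs : tsupport b ⊆ tsupport χ := closure_mono fun x hx h => hx (by rw [hb, h, mul_zero])
  have hg0 : g 0 = 0 := by
    have := hflat 0
    rw [← norm_eq_zero, norm_iteratedFDeriv_zero, norm_eq_zero] at this
    exact this
  have hdecomp : HasSum (fun j : ℤ => cutoff b ((2 : ℝ) ^ (-j)) g) g := by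
    refine hasSum_of_summable_seminorm (fun k m => ?_) fun x => ?_
    · obtain ⟨p', -, hp'⟩ := exists_seminorm_cutoff_zpow_le b hr (fun x hx => hχr x (hbs hx))
        (hbs.trans hχR) k m 1
      refine Summable.of_nonneg_of_le (fun j => apply_nonneg _ _) (fun j => hp' j g hflat) ?_
      simpa using hsumm.mul_right (p' g)
    · rcases eq_or_ne x 0 with rfl | hx
      · simp [cutoff_apply, hg0]
      · have h1 := (hχ x hx).mul_right (g x)
        rw [one_mul] at h1
        refine h1.congr_fun fun j => ?_
        rw [cutoff_apply, hb, φ.symbol_zero_zpow j]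
  -- The factor `φ_j` moves from the test function to `f`, producing the block, while `χ_j` stays
  -- with `g`.
  have hterm : ∀ j : ℤ, f (𝓕 (cutoff b ((2 : ℝ) ^ (-j)) g)) =
      φ.block j f (𝓕 (cutoff χ ((2 : ℝ) ^ (-j)) g)) := fun j => by
    rw [φ.block_apply, FourierTransform.fourierInv_fourier_eq]
    congr 2
    ext x
    rw [SchwartzMap.smulLeftCLM_apply_apply (φ.symbol_hasTemperateGrowth j), cutoff_apply,
      cutoff_apply, hb, smul_eq_mul, φ.symbol_zero_zpow j, mul_assoc]
  have hsum : HasSum (fun j : ℤ => φ.block j f (𝓕 (cutoff χ ((2 : ℝ) ^ (-j)) g))) (f ψ) := by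
    have h1 := (hdecomp.mapL 𝓕L).map (f : 𝓢(Rn n, ℂ) →+ ℂ) (map_continuous f)
    have hg : 𝓕L g = ψ := by
      rw [FourierTransform.fourierCLM_apply, FourierTransform.fourier_fourierInv_eq]
    rw [hg] at h1
    exact h1.congr_fun fun j => (hterm j).symm
  have hbound : ∀ j : ℤ, ‖φ.block j f (𝓕 (cutoff χ ((2 : ℝ) ^ (-j)) g))‖ ≤
      (2 : ℝ)⁻¹ ^ j.natAbs * (M * q g) := fun j => by
    have hfj := hf j
    obtain ⟨u, hu⟩ := exists_toTemperedDistribution_eq (ne_top_of_le_ne_top ENNReal.ofReal_ne_top hfj)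
    rw [← hu, lpENorm_toTemperedDistribution, ← ofReal_norm,
      ENNReal.ofReal_le_ofReal_iff (by positivity)] at hfj
    rw [← hu]
    have h1 : Q (𝓕 (cutoff χ ((2 : ℝ) ^ (-j)) g)) ≤ ((2 : ℝ)⁻¹ ^ K) ^ j.natAbs * q g :=
      hqb j g hflat
    have h2 : (2 : ℝ) ^ (-(j * s)) * ((2 : ℝ)⁻¹ ^ K) ^ j.natAbs ≤ (2 : ℝ)⁻¹ ^ j.natAbs := by
      have h3 : -(j * s) ≤ ((⌈|s|⌉₊ * j.natAbs : ℕ) : ℝ) := by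
        push_cast
        calc -(j * s) ≤ |(j : ℝ) * s| := neg_le_abs _
          _ = |s| * |(j : ℝ)| := by rw [abs_mul, mul_comm]
          _ ≤ ⌈|s|⌉₊ * |(j : ℝ)| := by gcongr; exact Nat.le_ceil _
          _ = _ := by rw [Nat.cast_natAbs, Int.cast_abs]
      calc (2 : ℝ) ^ (-(j * s)) * ((2 : ℝ)⁻¹ ^ K) ^ j.natAbs
          ≤ 2 ^ (⌈|s|⌉₊ * j.natAbs) * ((2 : ℝ)⁻¹ ^ K) ^ j.natAbs := by
            gcongr
            rw [← Real.rpow_natCast]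
            exact Real.rpow_le_rpow_of_exponent_le one_le_two h3
        _ = (2 : ℝ)⁻¹ ^ j.natAbs := by
            rw [pow_mul, ← mul_pow, pow_succ, ← mul_assoc, ← mul_pow]
            norm_num
    calc _ ≤ ‖u‖ * Q (𝓕 (cutoff χ ((2 : ℝ) ^ (-j)) g)) := hQb u _
      _ ≤ (2 ^ (-(j * s)) * M) * (((2 : ℝ)⁻¹ ^ K) ^ j.natAbs * q g) := by gcongr
      _ = (2 ^ (-(j * s)) * ((2 : ℝ)⁻¹ ^ K) ^ j.natAbs) * (M * q g) := by ring
      _ ≤ _ := by gcongr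
  calc ‖f ψ‖ = ‖∑' j : ℤ, φ.block j f (𝓕 (cutoff χ ((2 : ℝ) ^ (-j)) g))‖ := by rw [hsum.tsum_eq]
    _ ≤ S * (M * q g) := tsum_of_norm_bounded (hsumm.hasSum.mul_right _) hbound
    _ = _ := by ring

/-- The Besov norm in terms of the functions that represent the dyadic blocks. -/
theorem besovENorm_eq {φ : DyadicGenerator n} {s : ℝ} {p q : ℝ≥0∞} [Fact (1 ≤ p)]
    {f : TemperedModPoly n} {v : ℤ → Lp ℂ p (volume : Measure (Rn n))}
    (hv : ∀ j, Lp.toTemperedDistribution (v j) = φ.blockModPoly j f) :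
    besovENorm φ s p q f =
      eLpNorm (fun j : ℤ => (2 : ℝ) ^ ((j : ℝ) * s) * ‖v j‖) q Measure.count := by
  refine eLpNorm_congr_enorm_ae (Filter.Eventually.of_forall fun j => ?_)
  rw [enorm_eq_self, ← hv, lpENorm_toTemperedDistribution, enorm_mul, enorm_norm]
  congr 1
  rw [Real.enorm_of_nonneg (by positivity), ← ENNReal.ofReal_rpow_of_pos two_pos]
  simp

/-! ### The embedding, definiteness of the norm, and completeness. -/

namespace HomogeneousBesov

variable (φ : DyadicGenerator n) (s : ℝ) (p q : ℝ≥0∞) [Fact (1 ≤ p)] [Fact (1 ≤ q)]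

theorem ofReal_norm_eq (f : HomogeneousBesov φ s p q) :
    ENNReal.ofReal ‖f‖ = besovENorm φ s p q (incl φ s p q f) := by
  rw [norm_def, ENNReal.ofReal_toReal (besovENorm_incl_lt_top φ s p q f).ne]

/-- An `ℓ^q` norm dominates each entry. This reduces the estimate on `𝓢_∞` to the case `q = ∞`. -/
theorem lpENorm_blockModPoly_le (f : HomogeneousBesov φ s p q) (j : ℤ) :
    lpENorm p (φ.blockModPoly j (incl φ s p q f)) ≤
      ENNReal.ofReal (2 ^ (-(j * s)) * ‖f‖) := by
  have hq : q ≠ 0 := (one_pos.trans_le (Fact.out : 1 ≤ q)).ne'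
  have h1 := enorm_le_eLpNorm_count (fun j : ℤ => (2 : ℝ≥0∞) ^ ((j : ℝ) * s) *
    lpENorm p (φ.blockModPoly j (incl φ s p q f))) j hq
  rw [enorm_eq_self, ← besovENorm, ← ofReal_norm_eq] at h1
  rw [ENNReal.ofReal_mul (by positivity), ← ENNReal.ofReal_rpow_of_pos two_pos,
    ENNReal.ofReal_ofNat]
  calc lpENorm p (φ.blockModPoly j (incl φ s p q f))
      = 2 ^ (-(j * s)) * (2 ^ ((j : ℝ) * s) *
          lpENorm p (φ.blockModPoly j (incl φ s p q f))) := by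
        rw [← mul_assoc, ← ENNReal.rpow_add _ _ two_ne_zero ENNReal.ofNat_ne_top, neg_add_cancel,
          ENNReal.rpow_zero, one_mul]
    _ ≤ _ := by gcongr

theorem exists_seminorm_toSInfDual_le :
    ∃ P : Seminorm ℂ 𝓢(Rn n, ℂ), Continuous P ∧ ∀ (f : HomogeneousBesov φ s p q) (ψ : SInf n),
      ‖toSInfDual φ s p q f ψ‖ ≤ ‖f‖ * P ψ := by
  obtain ⟨P, hP, hb⟩ := φ.exists_seminorm_apply_le s p
  refine ⟨P, hP, fun f ψ => ?_⟩
  obtain ⟨g, hg⟩ := Submodule.Quotient.mk_surjective _ (incl φ s p q f)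
  have h1 : toSInfDual φ s p q f ψ = g (ψ : 𝓢(Rn n, ℂ)) := by
    change HomBesov.toSInfDual n (incl φ s p q f) ψ = _
    rw [← hg]
    rfl
  rw [h1]
  refine hb g ‖f‖ (norm_nonneg f) (fun j => ?_) ψ ψ.2
  have h2 := lpENorm_blockModPoly_le φ s p q f j
  rwa [← hg] at h2

theorem injective_toSInfDual : Function.Injective (toSInfDual φ s p q) :=
  toSInfDual_injective.comp (besovSubmodule φ s p q).subtype_injective

/-- For the topology of pointwise convergence it suffices that every evaluation at `ψ` is a bounded
functional; `P ψ` is a bound. -/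
theorem continuous_toSInfDual : Continuous (toSInfDual φ s p q) := by
  obtain ⟨P, -, hb⟩ := exists_seminorm_toSInfDual_le φ s p q
  refine PointwiseConvergenceCLM.continuous_of_continuous_eval fun ψ => ?_
  let T : HomogeneousBesov φ s p q →ₗ[ℂ] ℂ :=
    { toFun := fun f => toSInfDual φ s p q f ψ
      map_add' := fun f g => by rw [map_add]; rfl
      map_smul' := fun c f => by rw [map_smul]; rfl }
  exact AddMonoidHomClass.continuous_of_bound T (P ψ) fun f => (hb f ψ).trans_eq (mul_comm _ _)

theorem eq_zero_of_norm_eq_zero {f : HomogeneousBesov φ s p q} (hf : ‖f‖ = 0) : f = 0 := by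
  obtain ⟨P, -, hb⟩ := exists_seminorm_toSInfDual_le φ s p q
  refine injective_toSInfDual φ s p q ?_
  rw [map_zero]
  ext ψ
  have h := hb f ψ
  rw [hf, zero_mul] at h
  exact norm_le_zero_iff.1 h

theorem smulLeftCLM_symbol_mem_SInf (j : ℤ) (g : 𝓢(Rn n, ℂ)) :
    𝓕 (SchwartzMap.smulLeftCLM ℂ (φ.symbol j) g) ∈ SInf n := by
  refine fourier_mem_SInf ?_
  filter_upwards [φ.symbol_eventually_eq_zero j] with x hx
  rw [SchwartzMap.smulLeftCLM_apply_apply (φ.symbol_hasTemperateGrowth j), hx, zero_smul]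

/-- The dyadic blocks are determined by the restriction to `𝓢_∞`. -/
theorem blockModPoly_apply (j : ℤ) (f : TemperedModPoly n) (ψ : 𝓢(Rn n, ℂ)) :
    φ.blockModPoly j f ψ = HomBesov.toSInfDual n f
      ⟨𝓕 (SchwartzMap.smulLeftCLM ℂ (φ.symbol j) (𝓕⁻ ψ)),
        smulLeftCLM_symbol_mem_SInf φ j _⟩ := by
  induction f using Submodule.Quotient.induction_on with
  | H g => rfl

/-- A Cauchy sequence in the Besov space has a limit in `𝓢' / 𝒫`, in the sense of `𝓢_∞'`. -/
theorem exists_tendsto_toSInfDual {u : ℕ → HomogeneousBesov φ s p q} (hu : CauchySeq u) :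
    ∃ f : TemperedModPoly n, ∀ ψ : SInf n, Filter.Tendsto
      (fun k => toSInfDual φ s p q (u k) ψ) Filter.atTop (nhds (HomBesov.toSInfDual n f ψ)) := by
  obtain ⟨P, hP, hb⟩ := exists_seminorm_toSInfDual_le φ s p q
  have hconv : ∀ ψ : SInf n, ∃ z : ℂ, Filter.Tendsto
      (fun k => toSInfDual φ s p q (u k) ψ) Filter.atTop (nhds z) := fun ψ => by
    refine cauchySeq_tendsto_of_complete ?_
    refine Metric.cauchySeq_iff.2 fun ε hε => ?_
    -- `P ψ` may be zero, hence the added one before dividing.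
    have hP1 : 0 < P ψ + 1 := by have := apply_nonneg P (ψ : 𝓢(Rn n, ℂ)); positivity
    obtain ⟨N, hN⟩ := Metric.cauchySeq_iff.1 hu (ε / (P ψ + 1)) (by positivity)
    refine ⟨N, fun k hk l hl => ?_⟩
    have h1 := hN k hk l hl
    rw [dist_eq_norm] at h1 ⊢
    have h2 := hb (u k - u l) ψ
    rw [map_sub] at h2
    calc _ ≤ ‖u k - u l‖ * P ψ := h2
      _ ≤ ‖u k - u l‖ * (P ψ + 1) := by gcongr; linarith
      _ < ε := by rwa [← lt_div_iff₀ hP1]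
  choose T hT using hconv
  let TL : SInf n →ₗ[ℂ] ℂ :=
    { toFun := T
      map_add' := fun ψ χ => tendsto_nhds_unique (hT (ψ + χ)) (by
        simpa only [map_add] using (hT ψ).add (hT χ))
      map_smul' := fun c ψ => tendsto_nhds_unique (hT (c • ψ)) (by
        simpa only [map_smul, RingHom.id_apply] using (hT ψ).const_smul c) }
  obtain ⟨M, hM0, hM⟩ : ∃ M : ℝ, 0 ≤ M ∧ ∀ k, ‖u k‖ ≤ M := by
    obtain ⟨M, hM⟩ := hu.isBounded_range.exists_norm_le
    exact ⟨M, (norm_nonneg _).trans (hM _ ⟨0, rfl⟩), fun k => hM _ ⟨k, rfl⟩⟩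
  have hTb : ∀ ψ : SInf n, ‖TL ψ‖ ≤ (M.toNNReal • P) (ψ : 𝓢(Rn n, ℂ)) := fun ψ => by
    change ‖T ψ‖ ≤ M.toNNReal • P ψ
    rw [NNReal.smul_def, Real.coe_toNNReal _ hM0, smul_eq_mul]
    refine le_of_tendsto (hT ψ).norm (Filter.Eventually.of_forall fun k => ?_)
    exact (hb (u k) ψ).trans (by gcongr; exact hM k)
  have : PolynormableSpace ℂ 𝓢(Rn n, ℂ) :=
    (schwartz_withSeminorms ℂ (Rn n) ℂ).toPolynormableSpace
  -- Hahn–Banach: the limit functional, dominated on `𝓢_∞` by the seminorm `M P`, extends to all of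
  -- `𝓢` and so defines a class in `𝓢' / 𝒫`.
  obtain ⟨g, hg, -⟩ := Module.Dual.exists_continuous_extension_of_le_seminorm (SInf n) TL
    (hP.const_smul M.toNNReal) hTb
  let G : 𝓢'(Rn n, ℂ) := ContinuousLinearMap.toPointwiseConvergenceCLM _ _ _ _ g
  refine ⟨Submodule.Quotient.mk G, fun ψ => ?_⟩
  have h1 : HomBesov.toSInfDual n (Submodule.Quotient.mk G) ψ = T ψ := hg ψ
  rw [h1]
  exact hT ψ

instance : CompleteSpace (HomogeneousBesov φ s p q) := by
  refine Metric.complete_of_cauchySeq_tendsto fun u hu => ?_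
  obtain ⟨f, hf⟩ := exists_tendsto_toSInfDual φ s p q hu
  have hblock : ∀ (j : ℤ) (ψ : 𝓢(Rn n, ℂ)), Filter.Tendsto
      (fun k => φ.blockModPoly j (incl φ s p q (u k)) ψ) Filter.atTop
      (nhds (φ.blockModPoly j f ψ)) := fun j ψ => by
    simp only [blockModPoly_apply]
    exact hf _
  have hrep : ∀ (k : ℕ) (j : ℤ), ∃ v : Lp ℂ p (volume : Measure (Rn n)),
      Lp.toTemperedDistribution v = φ.blockModPoly j (incl φ s p q (u k)) := fun k j =>
    exists_toTemperedDistribution_eq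
      (ne_top_of_le_ne_top ENNReal.ofReal_ne_top (lpENorm_blockModPoly_le φ s p q (u k) j))
  choose v hv using hrep
  have htd_sub : ∀ a b : Lp ℂ p (volume : Measure (Rn n)), Lp.toTemperedDistribution (a - b) =
      Lp.toTemperedDistribution a - Lp.toTemperedDistribution b :=
    map_sub (Lp.toTemperedDistributionCLM ℂ (volume : Measure (Rn n)) p)
  have hvd : ∀ k l j, Lp.toTemperedDistribution (v k j - v l j) =
      φ.blockModPoly j (incl φ s p q (u k - u l)) := fun k l j => by
    rw [htd_sub, hv, hv, map_sub, map_sub]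
  have hvdist : ∀ k l j, ‖v k j - v l j‖ ≤ 2 ^ (-(j * s)) * ‖u k - u l‖ := fun k l j => by
    have h1 := lpENorm_blockModPoly_le φ s p q (u k - u l) j
    rwa [← hvd, lpENorm_toTemperedDistribution, ← ofReal_norm,
      ENNReal.ofReal_le_ofReal_iff (by positivity)] at h1
  have hlim : ∀ j, ∃ w : Lp ℂ p (volume : Measure (Rn n)),
      Filter.Tendsto (fun k => v k j) Filter.atTop (nhds w) := fun j => by
    refine cauchySeq_tendsto_of_complete (Metric.cauchySeq_iff.2 fun ε hε => ?_)
    have hc : (0 : ℝ) < 2 ^ (-(j * s)) := by positivity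
    obtain ⟨N, hN⟩ := Metric.cauchySeq_iff.1 hu (ε / 2 ^ (-(j * s))) (by positivity)
    refine ⟨N, fun k hk l hl => ?_⟩
    have h1 := hN k hk l hl
    rw [dist_eq_norm] at h1 ⊢
    exact (hvdist k l j).trans_lt (by rwa [← lt_div_iff₀' hc])
  choose w hw using hlim
  -- The blocks converge to `w j` in `L^p` and to the block of `f` weakly in `𝓢'`; the two limits
  -- agree.
  have hwf : ∀ j, Lp.toTemperedDistribution (w j) = φ.blockModPoly j f := fun j => by
    ext ψ
    have h1 : Filter.Tendsto (fun k => Lp.toTemperedDistribution (v k j) ψ) Filter.atTop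
        (nhds (Lp.toTemperedDistribution (w j) ψ)) :=
      (((PointwiseConvergenceCLM.evalCLM (RingHom.id ℂ) ℂ ψ).continuous.comp
        (Lp.toTemperedDistributionCLM ℂ (volume : Measure (Rn n)) p).continuous).tendsto _).comp
          (hw j)
    refine tendsto_nhds_unique h1 ?_
    simpa only [hv] using hblock j ψ
  have hdiff : ∀ k j, Lp.toTemperedDistribution (v k j - w j) =
      φ.blockModPoly j (incl φ s p q (u k) - f) := fun k j => by
    rw [htd_sub, hv, hwf, map_sub]
  have hclose : ∀ ε : ℝ, 0 < ε → ∃ N, ∀ k ≥ N,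
      besovENorm φ s p q (incl φ s p q (u k) - f) ≤ ENNReal.ofReal ε := fun ε hε => by
    obtain ⟨N, hN⟩ := Metric.cauchySeq_iff.1 hu ε hε
    refine ⟨N, fun k hk => ?_⟩
    rw [besovENorm_eq (hdiff k)]
    -- Fatou's lemma in `ℓ^q`: with `k` fixed and `l → ∞`, the Cauchy bound for `u k - u l` passes
    -- to `u k - f`.
    refine Lp.eLpNorm_le_of_ae_tendsto (u := Filter.atTop)
      (f := fun (l : ℕ) (j : ℤ) => (2 : ℝ) ^ ((j : ℝ) * s) * ‖v k j - v l j‖)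
      ((Filter.eventually_ge_atTop N).mono fun l hl => ?_)
      (fun l => (measurable_of_countable _).aestronglyMeasurable)
      (Filter.Eventually.of_forall fun j => ((tendsto_const_nhds.sub (hw j)).norm.const_mul _))
    rw [← besovENorm_eq (hvd k l), ← ofReal_norm_eq]
    have h1 := hN k hk l hl
    rw [dist_eq_norm] at h1
    exact ENNReal.ofReal_le_ofReal h1.le
  -- `f = u N - (u N - f)`, a difference of two elements of finite norm.
  have hfmem : f ∈ besovSubmodule φ s p q := by
    obtain ⟨N, hN⟩ := hclose 1 one_pos
    have h1 : incl φ s p q (u N) - f ∈ besovSubmodule φ s p q :=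
      (hN N le_rfl).trans_lt ENNReal.ofReal_lt_top
    have h2 := (besovSubmodule φ s p q).sub_mem (u N).2 h1
    rwa [show ((u N).1 : TemperedModPoly n) = incl φ s p q (u N) from rfl, sub_sub_cancel] at h2
  let F : HomogeneousBesov φ s p q := ⟨f, hfmem⟩
  refine ⟨F, Metric.tendsto_atTop.2 fun ε hε => ?_⟩
  obtain ⟨N, hN⟩ := hclose (ε / 2) (by positivity)
  refine ⟨N, fun k hk => ?_⟩
  rw [dist_eq_norm]
  have h1 : ENNReal.ofReal ‖u k - F‖ ≤ ENNReal.ofReal (ε / 2) := by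
    rw [ofReal_norm_eq, map_sub]
    exact hN k hk
  rw [ENNReal.ofReal_le_ofReal_iff (by positivity)] at h1
  linarith

end HomogeneousBesov

end HomBesov

end

theorem mainTheorem1 (n : ℕ) (p q : ℝ≥0∞) [Fact (1 ≤ p)] [Fact (1 ≤ q)] (s : ℝ)
    (φ : HomBesov.DyadicGenerator n) :
    (Function.Injective (HomBesov.HomogeneousBesov.toSInfDual φ s p q) ∧
      Continuous (HomBesov.HomogeneousBesov.toSInfDual φ s p q)) ∧
    ((∀ f : HomBesov.HomogeneousBesov φ s p q, ‖f‖ = 0 → f = 0) ∧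
      CompleteSpace (HomBesov.HomogeneousBesov φ s p q)) :=
  ⟨⟨HomBesov.HomogeneousBesov.injective_toSInfDual φ s p q,
    HomBesov.HomogeneousBesov.continuous_toSInfDual φ s p q⟩,
    fun _ hf => HomBesov.HomogeneousBesov.eq_zero_of_norm_eq_zero φ s p q hf, inferInstance⟩
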